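/- For every integer $N\ge 1$ let $\mathbf r(N)=(r_1(N)\ge\cdots\ge r_{m(N)}(N))$ and $\mathbf c(N)=(c_1(N)\ge\cdots\ge c_{n(N)}(N))$ be vectors of non-negative integers with $\sum_i r_i(N)=\sum_j c_j(N)=N$ and $r_1(N)\ge c_1(N)$; extend both vectors by zeros to infinite vectors. Let $\Omega_{\mathbf r,\mathbf c}$ be the set of $0/1$-matrices with row sums $\mathbf r$ and column sums $\mathbf c$. The configuration model takes $r_i$ tokens of type 1 for each row $i$ and $c_j$ tokens of type 2 for each column $j$, draws a uniformly random perfect matching between type-1 and type-2 tokens, and outputs the table $T$ whose entry $T_{i,j}$ is the number of type-1 tokens of row $i$ that are matched to type-2 tokens of column $j$. A subsequence $S'$ of $S=(\mathbf r(N),\mathbf c(N),N)_{N\ge 1}$ is given by indices $k_1<k_2<\cdots$ and consists of the tuples $(\mathbf r'(\ell),\mathbf c'(\ell),N'(\ell))=(\mathbf r(k_\ell),\mathbf c(k_\ell),k_\ell)$. Put $\kappa(S')=\min\{i\ge 1: r'_i(\ell)=o(N'(\ell))\text{ as }\ell\to\infty\}$, with $\kappa(S')=\infty$ if there is no such $i$.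 Theorem. $\Pr(T\in\Omega_{\mathbf r,\mathbf c})=\Omega(1)$ as $N\to\infty$ if and only if the following two conditions hold. (1) $\sum_{i=1}^{m}\sum_{j=1}^{n} r_i(r_i-1)c_j(c_j-1)=O(N^2)$. (2) For every subsequence $S'$ of $S$ with $\kappa(S')<\infty$, either $$\limsup_{\ell\to\infty}\sum_{i\ge\kappa(S')}\frac{r'_i(\ell)}{N'(\ell)}>0\qquad\text{or}\qquad \limsup_{\ell\to\infty}c'_1(\ell)<\kappa(S').$$ -/

import Mathlib

open Filter Asymptotics Topology

noncomputable section

/-- Row sums `r` (of length `m`) and column sums `c` (of length `n`): finite non-increasing vectors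
of non-negative integers with a common total. -/
structure Margins where
  m : ℕ
  n : ℕ
  r : Fin m → ℕ
  c : Fin n → ℕ
  r_anti : Antitone r
  c_anti : Antitone c
  sum_eq : ∑ i, r i = ∑ j, c j

namespace Margins

/-- The common total `N` of the row sums and of the column sums. -/
def total (M : Margins) : ℕ := ∑ i, M.r i

/-- The row sums as an infinite vector `r_1, r_2, …`, extended by zeros after `r_m`
(index `0` is unused and carries the value `0`). -/
def row (M : Margins) (i : ℕ) : ℕ :=
  if h : 1 ≤ i ∧ i ≤ M.m then M.r ⟨i - 1, by omega⟩ else 0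

/-- The column sums as an infinite vector `c_1, c_2, …`, extended by zeros after `c_n`
(index `0` is unused and carries the value `0`). -/
def col (M : Margins) (j : ℕ) : ℕ :=
  if h : 1 ≤ j ∧ j ≤ M.n then M.c ⟨j - 1, by omega⟩ else 0

/-- Type-1 tokens: `r_i` labelled tokens for each row `i`. -/
abbrev RowToken (M : Margins) : Type := Σ i : Fin M.m, Fin (M.r i)

/-- Type-2 tokens: `c_j` labelled tokens for each column `j`. -/
abbrev ColToken (M : Margins) : Type := Σ j : Fin M.n, Fin (M.c j)

/-- The perfect matchings between type-1 and type-2 tokens. -/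
abbrev Matching (M : Margins) : Type := M.RowToken ≃ M.ColToken

instance (M : Margins) : Nonempty M.Matching := by
  have h : Fintype.card M.RowToken = Fintype.card M.ColToken := by
    simp [M.sum_eq]
  exact ⟨Fintype.equivOfCardEq h⟩

/-- The table of a matching: the entry `(i, j)` is the number of tokens of row `i` that are matched
to tokens of column `j`. -/
def table (M : Margins) (σ : M.Matching) : Matrix (Fin M.m) (Fin M.n) ℕ :=
  fun i j => Fintype.card {t : Fin (M.r i) // (σ ⟨i, t⟩).1 = j}

/-- The configuration model: the law of the table of a uniformly random matching. -/
def configurationModel (M : Margins) : PMF (Matrix (Fin M.m) (Fin M.n) ℕ) :=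
  (PMF.uniformOfFintype M.Matching).map M.table

/-- The binary contingency tables with row sums `r` and column sums `c`. -/
def binaryTables (M : Margins) : Set (Matrix (Fin M.m) (Fin M.n) ℕ) :=
  {A | (∀ i j, A i j = 0 ∨ A i j = 1) ∧ (∀ i, ∑ j, A i j = M.r i) ∧ (∀ j, ∑ i, A i j = M.c j)}

/-- The probability that the configuration model outputs a binary contingency table. -/
def probBinary (M : Margins) : ℝ :=
  (M.configurationModel.toOuterMeasure M.binaryTables).toReal

/-- `∑_{i=1}^m ∑_{j=1}^n r_i (r_i - 1) c_j (c_j - 1)`, computed in the reals. -/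
def doubleSum (M : Margins) : ℝ :=
  ∑ i, ∑ j, (M.r i : ℝ) * ((M.r i : ℝ) - 1) * ((M.c j : ℝ) * ((M.c j : ℝ) - 1))

/-- `∑_{i ≥ k} r_i / N`, where rows are numbered from `1`; it is `0` for `k = ∞`. -/
def tail (M : Margins) (k : ℕ∞) : ℝ :=
  ∑ i : Fin M.m, if k ≤ ((i.val + 1 : ℕ) : ℕ∞) then (M.r i : ℝ) / (M.total : ℝ) else 0

end Margins

/-- The least index `i ≥ 1` with `r_i(ℓ) = o(N(ℓ))` as `ℓ → ∞`, and `∞` if there is none. -/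
def kappa (S : ℕ → Margins) : ℕ∞ :=
  sInf {k : ℕ∞ | ∃ i : ℕ, 1 ≤ i ∧ k = (i : ℕ∞) ∧
    (fun l => ((S l).row i : ℝ)) =o[atTop] (fun l => ((S l).total : ℝ))}

end

/-!
A matching produces a binary table exactly when it is simple, that is, when no two tokens of one row
are matched into one column. Call an ordered pair of distinct tokens of one row matched into one
column a collision, and write `R = ∑ r_i (r_i - 1)` and `S = ∑ c_j (c_j - 1)`. Then
`doubleSum = R S`, and the mean number of collisions is `μ = R S / (N (N - 1))`.

*Necessity of (1).* Two collisions either use four different row tokens, and are then almost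
independent, or share a token; the latter contribute only `O(μ + μ^(3/2))` to the variance, because
`r_1² ≤ 2 R` and `c_1² ≤ 2 S`. By Chebyshev's inequality a simple matching has probability at most
`12 / N + 4 / μ + 16 / √μ` (`card_isSimpleMatching_le`), so it is rare unless `R S = O(N²)`.

*Necessity of (2).* If `c_1 ≥ κ`, then by the pigeonhole principle one of `κ` tokens of the first
column has to be matched into the rows `κ, κ + 1, …`, so the probability is at most `κ` times the
fraction of mass in these rows (`card_isSimpleMatching_le_of_pigeonhole`).

*Sufficiency, `r_1 ≤ δ N`.* A collision is the event that the random matching contains a given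
partial matching of size two. Such an event is negatively dependent on any family of events which
share no token with it (`card_realises_avoiding_of_disjoint`), so the lopsided local lemma of Erdős
and Spencer applies. Its condition asks that `(r_1 - 1) S + (c_1 - 1) R` be small against `N²`, and
this follows from `R S ≤ C N²` and `c_1 ≤ r_1 ≤ δ N` (`Margins.le_probBinary_of_light`). The local
lemma bounds the probability below by `(1 - 2 / (N (N - 1))) ^ (R S)`, hence by a constant.

*Sufficiency, `r_1 > δ N`.* Now `R` is of order `N²`, so `S` is bounded: boundedly many tokens lie in
columns of size at least two. Condition (2) implies that the rows `c_1, c_1 + 1, …` carry a positive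
fraction of the mass (`eventually_le_tail`), so that every such token, exposed in turn, avoids the
fewer than `c_1` rows which its column already uses with probability bounded below
(`card_simpleOn_insert`, `Margins.le_probBinary_of_few`).
-/

/-! ### Matchings extending a partial matching -/

section Counting

variable {α β ι κ : Type*} [Fintype α] [Fintype β] [DecidableEq α] [DecidableEq β]

/-- Of the `N!` matchings, a fraction `1 / (N (N - 1) ⋯ (N - k + 1))` extends a given partial matching
of size `k`: by symmetry under permutations of `β`, all of these partial matchings have equally many
extensions. -/
theorem card_equiv_extending (h : Fintype.card α = Fintype.card β) {k : ℕ}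
    (f : Fin k → α) (g : Fin k → β) (hf : f.Injective) (hg : g.Injective) :
    (Finset.univ.filter fun σ : α ≃ β => ∀ i, σ (f i) = g i).card *
      (Fintype.card α).descFactorial k = (Fintype.card α).factorial := by
  have key : ∀ g' : Fin k ↪ β,
      (Finset.univ.filter fun σ : α ≃ β => ∀ i, σ (f i) = g' i).card =
      (Finset.univ.filter fun σ : α ≃ β => ∀ i, σ (f i) = g i).card := by
    intro g'
    obtain ⟨τ, hτ⟩ : ∃ τ : Equiv.Perm β, ∀ i, τ (g i) = g' i := by
      let e : Set.range g ≃ Set.range g' :=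
        (Equiv.ofInjective g hg).symm.trans (Equiv.ofInjective g' g'.injective)
      classical
      refine ⟨Equiv.extendSubtype e, fun i => ?_⟩
      rw [Equiv.extendSubtype_apply_of_mem e (g i) ⟨i, rfl⟩]
      have h1 : (⟨g i, ⟨i, rfl⟩⟩ : Set.range g) = Equiv.ofInjective g hg i := rfl
      rw [Equiv.trans_apply, h1, Equiv.symm_apply_apply, Equiv.ofInjective_apply]
    symm
    refine Finset.card_bij' (fun σ _ => σ.trans τ) (fun σ _ => σ.trans τ.symm) ?_ ?_ ?_ ?_
    · intro σ hσ; simp at hσ ⊢; intro i; rw [hσ, hτ]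
    · intro σ hσ; simp at hσ ⊢; intro i; rw [hσ, ← hτ]; simp
    · intro σ _; ext; simp
    · intro σ _; ext; simp
  have h1 : ∑ g' : Fin k ↪ β,
      (Finset.univ.filter fun σ : α ≃ β => ∀ i, σ (f i) = g' i).card =
      Fintype.card (α ≃ β) := by
    rw [← Finset.card_univ, Finset.card_eq_sum_card_fiberwise
      (f := fun σ : α ≃ β => (⟨f, hf⟩ : Fin k ↪ α).trans σ.toEmbedding)
      (t := Finset.univ) (by intro _ _; simp)]
    refine Finset.sum_congr rfl fun g' _ => ?_
    congr 1
    ext σ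
    simp [Function.Embedding.ext_iff]
  rw [Finset.sum_congr rfl fun g' _ => key g', Finset.sum_const, Finset.card_univ,
    Fintype.card_embedding_eq, Fintype.card_equiv (Fintype.equivOfCardEq h), smul_eq_mul,
    Fintype.card_fin, ← h] at h1
  rw [mul_comm]; exact h1

/-! ### Collisions -/

/-- A matching is simple if no two tokens of one row are matched into the same column. Here `ρ` and
`γ` send a token to its row and to its column. -/
def IsSimpleMatching (ρ : α → ι) (γ : β → κ) (σ : α ≃ β) : Prop :=
  ∀ s t, ρ s = ρ t → γ (σ s) = γ (σ t) → s = t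

instance [DecidableEq ι] [DecidableEq κ] (ρ : α → ι) (γ : β → κ) :
    DecidablePred (IsSimpleMatching ρ γ) := fun σ => by
  unfold IsSimpleMatching; infer_instance

/-- The ordered pairs of distinct tokens lying in a common fiber of `ρ`. -/
def fiberPairs [DecidableEq ι] (ρ : α → ι) : Finset (α × α) :=
  Finset.univ.filter fun p => p.1 ≠ p.2 ∧ ρ p.1 = ρ p.2

theorem card_fiberPairs [DecidableEq ι] (ρ : α → ι) :
    (fiberPairs ρ).card = ∑ s, ((Finset.univ.filter fun t => ρ t = ρ s).card - 1) := by
  rw [Finset.card_eq_sum_card_fiberwise (f := Prod.fst) (t := Finset.univ) (by intro _ _; simp)]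
  refine Finset.sum_congr rfl fun s _ => ?_
  rw [← Finset.card_erase_of_mem (a := s) (by simp)]
  refine Finset.card_bij' (fun p _ => p.2) (fun t _ => (s, t)) ?_ ?_ ?_ ?_
  · rintro ⟨a, b⟩ h
    simp [fiberPairs] at h ⊢
    obtain ⟨⟨h1, h2⟩, rfl⟩ := h
    exact ⟨fun h => h1 h.symm, h2.symm⟩
  · intro t h
    simp [fiberPairs] at h ⊢
    exact ⟨fun h' => h.1 h'.symm, h.2.symm⟩
  · rintro ⟨a, b⟩ h
    simp [fiberPairs] at h ⊢
    exact h.2.symm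
  · simp

theorem card_filter_fiberPairs_fst_le [DecidableEq ι] (ρ : α → ι) (s : α) :
    ((fiberPairs ρ).filter fun p => p.1 = s).card ≤
      (Finset.univ.filter fun t => ρ t = ρ s).card - 1 := by
  rw [← Finset.card_erase_of_mem (a := s) (by simp)]
  refine Finset.card_le_card_of_injOn Prod.snd ?_ ?_
  · rintro ⟨a, b⟩ h
    simp only [fiberPairs, Finset.mem_coe, Finset.mem_filter, Finset.mem_univ, true_and,
      Finset.mem_erase] at h ⊢
    obtain ⟨⟨h1, h2⟩, rfl⟩ := h
    exact ⟨fun h => h1 h.symm, h2.symm⟩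
  · rintro ⟨a, b⟩ h ⟨a', b'⟩ h' hb
    simp at h h' hb
    simp [h.2, h'.2, hb]

theorem card_filter_fiberPairs_snd_le [DecidableEq ι] (ρ : α → ι) (s : α) :
    ((fiberPairs ρ).filter fun p => p.2 = s).card ≤
      (Finset.univ.filter fun t => ρ t = ρ s).card - 1 := by
  rw [← Finset.card_erase_of_mem (a := s) (by simp)]
  refine Finset.card_le_card_of_injOn Prod.fst ?_ ?_
  · rintro ⟨a, b⟩ h
    simp only [fiberPairs, Finset.mem_coe, Finset.mem_filter, Finset.mem_univ, true_and,
      Finset.mem_erase] at h ⊢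
    obtain ⟨⟨h1, h2⟩, rfl⟩ := h
    exact ⟨h1, h2⟩
  · rintro ⟨a, b⟩ h ⟨a', b'⟩ h' hb
    simp at h h' hb
    simp [h.2, h'.2, hb]

/-! ### The local lemma for matchings -/

/-- The matching `σ` realises the partial matching `e.1.1 ↦ e.2.1`, `e.1.2 ↦ e.2.2`. -/
def Realises (σ : α ≃ β) (e : (α × α) × (β × β)) : Prop :=
  σ e.1.1 = e.2.1 ∧ σ e.1.2 = e.2.2

instance (σ : α ≃ β) : DecidablePred (Realises σ) := fun e => by
  unfold Realises; infer_instance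

theorem isSimpleMatching_iff [DecidableEq ι] [DecidableEq κ] (ρ : α → ι) (γ : β → κ) (σ : α ≃ β) :
    IsSimpleMatching ρ γ σ ↔ ∀ e ∈ fiberPairs ρ ×ˢ fiberPairs γ, ¬ Realises σ e := by
  constructor
  · rintro h ⟨⟨s, t⟩, ⟨u, v⟩⟩ he ⟨h1, h2⟩
    simp [fiberPairs] at he h1 h2
    subst h1 h2
    exact he.1.1 (h s t he.1.2 he.2.2)
  · intro h s t h1 h2
    by_contra h3
    exact h ((s, t), (σ s, σ t)) (by simp [fiberPairs, h1, h2, h3]) ⟨rfl, rfl⟩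

/-- The matchings that realise none of the partial matchings in `S`. -/
def avoiding (S : Finset ((α × α) × (β × β))) : Finset (α ≃ β) :=
  Finset.univ.filter fun σ => ∀ e ∈ S, ¬ Realises σ e

theorem mem_avoiding {S : Finset ((α × α) × (β × β))} {σ : α ≃ β} :
    σ ∈ avoiding S ↔ ∀ e ∈ S, ¬ Realises σ e := by
  simp [avoiding]

/-- Two partial matchings share a token. -/
def Touches (e f : (α × α) × (β × β)) : Prop :=
  (f.1.1 = e.1.1 ∨ f.1.1 = e.1.2 ∨ f.1.2 = e.1.1 ∨ f.1.2 = e.1.2) ∨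
  (f.2.1 = e.2.1 ∨ f.2.1 = e.2.2 ∨ f.2.2 = e.2.1 ∨ f.2.2 = e.2.2)

instance (e : (α × α) × (β × β)) : DecidablePred (Touches e) := fun f => by
  unfold Touches; infer_instance

/-- Negative dependency: avoiding partial matchings disjoint from `e` does not make `e` more likely.
A matching realising `e` is turned into one sending `e.1` to any other prescribed pair of tokens by a
permutation which moves only the four tokens concerned; this creates no forbidden partial matching. -/
theorem card_realises_avoiding_of_disjoint (S : Finset ((α × α) × (β × β))) (e : (α × α) × (β × β))
    (h1 : e.1.1 ≠ e.1.2) (h2 : e.2.1 ≠ e.2.2) (hS : ∀ f ∈ S, ¬ Touches e f) :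
    (Fintype.card β * (Fintype.card β - 1)) *
      ((avoiding S).filter fun σ => Realises σ e).card ≤ (avoiding S).card := by
  obtain ⟨⟨s, t⟩, ⟨u, v⟩⟩ := e
  simp only at h1 h2
  rw [Finset.card_eq_sum_card_fiberwise (s := avoiding S) (f := fun σ => (σ s, σ t))
    (t := (Finset.univ : Finset β).offDiag) (by intro σ _; simpa using h1)]
  have hc : (Finset.univ : Finset β).offDiag.card = Fintype.card β * (Fintype.card β - 1) := by
    rw [Finset.offDiag_card, Finset.card_univ, Nat.mul_sub, mul_one]
  rw [← hc, ← smul_eq_mul, ← Finset.sum_const]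
  refine Finset.sum_le_sum ?_
  rintro ⟨u', v'⟩ hu'
  simp at hu'
  have hx : Equiv.swap u u' v ≠ u' := by
    intro h
    rw [Equiv.swap_apply_eq_iff, Equiv.swap_apply_right] at h
    exact h2 h.symm
  let τ : Equiv.Perm β := (Equiv.swap u u').trans (Equiv.swap (Equiv.swap u u' v) v')
  have τu : τ u = u' := by
    simp only [τ, Equiv.trans_apply, Equiv.swap_apply_left]
    exact Equiv.swap_apply_of_ne_of_ne hx.symm hu'
  have τv : τ v = v' := by simp [τ]
  have τb : ∀ b, b ≠ u → b ≠ v → b ≠ u' → b ≠ v' → τ b = b := by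
    intro b b1 b2 b3 b4
    simp only [τ, Equiv.trans_apply]
    rw [Equiv.swap_apply_of_ne_of_ne b1 b3]
    refine Equiv.swap_apply_of_ne_of_ne ?_ b4
    intro h
    have := congrArg (Equiv.swap u u') h
    rw [Equiv.swap_apply_of_ne_of_ne b1 b3, Equiv.swap_apply_self] at this
    exact b2 this
  refine Finset.card_le_card_of_injOn (fun σ => σ.trans τ) ?_ ?_
  · intro σ hσ
    obtain ⟨hσ, hs, ht⟩ := Finset.mem_filter.1 (Finset.mem_coe.1 hσ)
    rw [mem_avoiding] at hσ
    simp only at hs ht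
    refine Finset.mem_coe.2 (Finset.mem_filter.2 ⟨mem_avoiding.2 ?_, by simp [hs, ht, τu, τv]⟩)
    rintro ⟨⟨a, b⟩, ⟨x, y⟩⟩ hf ⟨hax, hby⟩
    have hd := hS _ hf
    simp only [Touches, not_or] at hd
    simp only [Equiv.trans_apply] at hax hby
    -- a token outside `s`, `t` whose new image is none of `u`, `v` kept its image
    have back : ∀ a x, τ (σ a) = x → a ≠ s → a ≠ t → x ≠ u → x ≠ v → σ a = x := by
      intro a x hax as at' xu xv
      have x1 : x ≠ u' := by
        rintro rfl
        exact as (σ.injective (τ.injective (by rw [hax, hs, τu])))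
      have x2 : x ≠ v' := by
        rintro rfl
        exact at' (σ.injective (τ.injective (by rw [hax, ht, τv])))
      exact τ.injective (by rw [hax, τb x xu xv x1 x2])
    exact hσ _ hf ⟨back a x hax hd.1.1 hd.1.2.1 hd.2.1 hd.2.2.1,
      back b y hby hd.1.2.2.1 hd.1.2.2.2 hd.2.2.2.1 hd.2.2.2.2⟩
  · intro σ _ σ' _ h
    ext a
    have := congrArg (fun f => τ.symm (f a)) h
    simpa using this

/-- The lopsided local lemma, symmetric form: if every partial matching of `E` touches at most `D`
others and `4 D ≤ N (N - 1)`, then conditioning on avoiding part of `E` at most doubles the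
probability `1 / (N (N - 1))` of realising a member of `E`. -/
theorem card_realises_avoiding_le (E : Finset ((α × α) × (β × β)))
    (hE : ∀ e ∈ E, e.1.1 ≠ e.1.2 ∧ e.2.1 ≠ e.2.2) (D : ℕ)
    (hD : ∀ e ∈ E, (E.filter (Touches e)).card ≤ D)
    (hDN : 4 * D ≤ Fintype.card β * (Fintype.card β - 1)) (S : Finset ((α × α) × (β × β))) :
    S ⊆ E → ∀ e ∈ E, (Fintype.card β * (Fintype.card β - 1)) *
      ((avoiding S).filter fun σ => Realises σ e).card ≤ 2 * (avoiding S).card := by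
  induction S using Finset.strongInduction with
  | H S ih =>
  intro hSE e he
  set M := Fintype.card β * (Fintype.card β - 1) with hM
  -- split off the members of `S` that touch `e`; `e` is negatively dependent on the others
  set S₁ := S.filter (Touches e)
  set S₂ := S.filter fun f => ¬ Touches e f
  have hS₂ : S₂ ⊆ S := Finset.filter_subset _ _
  have mono : avoiding S ⊆ avoiding S₂ := by
    intro σ hσ
    simp only [avoiding, Finset.mem_filter, Finset.mem_univ, true_and] at hσ ⊢
    exact fun f hf => hσ f (hS₂ hf)
  have a1 : M * ((avoiding S₂).filter fun σ => Realises σ e).card ≤ (avoiding S₂).card :=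
    card_realises_avoiding_of_disjoint S₂ e (hE e he).1 (hE e he).2
      (fun f hf => (Finset.mem_filter.1 hf).2)
  have a2 : ((avoiding S).filter fun σ => Realises σ e).card ≤
      ((avoiding S₂).filter fun σ => Realises σ e).card :=
    Finset.card_le_card (Finset.filter_subset_filter _ mono)
  have a3 : (avoiding S₂).card ≤ (avoiding S).card +
      ∑ f ∈ S₁, ((avoiding S₂).filter fun σ => Realises σ f).card := by
    have : avoiding S₂ ⊆ avoiding S ∪
        S₁.biUnion fun f => (avoiding S₂).filter fun σ => Realises σ f := by
      intro σ hσ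
      by_cases h : σ ∈ avoiding S
      · exact Finset.mem_union_left _ h
      · refine Finset.mem_union_right _ ?_
        simp only [avoiding, Finset.mem_filter, Finset.mem_univ, true_and, not_forall,
          not_not] at h
        obtain ⟨f, hf, hr⟩ := h
        refine Finset.mem_biUnion.2 ⟨f, ?_, Finset.mem_filter.2 ⟨hσ, hr⟩⟩
        by_contra hf1
        have hf2 : f ∈ S₂ := by
          simp only [S₁, S₂, Finset.mem_filter, not_and] at hf1 ⊢
          exact ⟨hf, hf1 hf⟩
        exact (Finset.mem_filter.1 hσ).2 f hf2 hr
    calc (avoiding S₂).card ≤ _ := Finset.card_le_card this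
      _ ≤ _ := Finset.card_union_le _ _
      _ ≤ _ := by gcongr; exact Finset.card_biUnion_le
  have a4 : ∀ f ∈ S₁, M * ((avoiding S₂).filter fun σ => Realises σ f).card ≤
      2 * (avoiding S₂).card := by
    intro f hf
    have hf' := Finset.mem_filter.1 hf
    refine ih S₂ ?_ (hS₂.trans hSE) f (hSE hf'.1)
    refine Finset.ssubset_iff_subset_ne.2 ⟨hS₂, fun h => ?_⟩
    have : f ∈ S₂ := h ▸ hf'.1
    exact (Finset.mem_filter.1 this).2 hf'.2
  have a5 : M * ∑ f ∈ S₁, ((avoiding S₂).filter fun σ => Realises σ f).card ≤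
      D * (2 * (avoiding S₂).card) := by
    rw [Finset.mul_sum]
    refine (Finset.sum_le_card_nsmul _ _ _ a4).trans ?_
    rw [smul_eq_mul]
    gcongr
    exact (Finset.card_le_card (Finset.filter_subset_filter _ hSE)).trans (hD e he)
  have hMpos : 0 < M := by
    have : 1 < Fintype.card β := Fintype.one_lt_card_iff.2 ⟨_, _, (hE e he).2⟩
    exact Nat.mul_pos (by omega) (by omega)
  have a6 : (avoiding S₂).card ≤ 2 * (avoiding S).card := by
    have h1 : M * (avoiding S₂).card ≤ M * (avoiding S).card + D * (2 * (avoiding S₂).card) := by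
      calc _ ≤ M * _ := Nat.mul_le_mul_left M a3
        _ ≤ _ := by rw [mul_add]; gcongr
    have h2 : 4 * D * (avoiding S₂).card ≤ M * (avoiding S₂).card := Nat.mul_le_mul_right _ hDN
    refine le_of_mul_le_mul_left (a := M) ?_ hMpos
    nlinarith
  calc _ ≤ M * _ := Nat.mul_le_mul_left M a2
    _ ≤ _ := a1
    _ ≤ _ := a6

/-- The conclusion of the local lemma, with the factor `1 - 2 / (N (N - 1))` for each member of `S`. -/
theorem le_card_avoiding (E : Finset ((α × α) × (β × β)))
    (hE : ∀ e ∈ E, e.1.1 ≠ e.1.2 ∧ e.2.1 ≠ e.2.2) (D : ℕ)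
    (hD : ∀ e ∈ E, (E.filter (Touches e)).card ≤ D)
    (hDN : 4 * D ≤ Fintype.card β * (Fintype.card β - 1)) (hN : 2 ≤ Fintype.card β)
    (S : Finset ((α × α) × (β × β))) (hS : S ⊆ E) :
    (1 - 2 / ((Fintype.card β : ℝ) * (Fintype.card β - 1))) ^ S.card * (Fintype.card (α ≃ β) : ℝ)
      ≤ (avoiding S).card := by
  have hN' : (2 : ℝ) ≤ Fintype.card β := by exact_mod_cast hN
  set x : ℝ := (Fintype.card β : ℝ) * (Fintype.card β - 1) with hx
  have hx2 : 2 ≤ x := by nlinarith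
  induction S using Finset.induction_on with
  | empty => simp [avoiding, Finset.card_univ]
  | insert e S he ih =>
    have ih := ih ((Finset.subset_insert _ _).trans hS)
    have h1 := card_realises_avoiding_le E hE D hD hDN S ((Finset.subset_insert _ _).trans hS) e
      (hS (Finset.mem_insert_self _ _))
    have h2 : x * ((avoiding S).filter fun σ => Realises σ e).card ≤ 2 * (avoiding S).card := by
      have : ((Fintype.card β * (Fintype.card β - 1) : ℕ) : ℝ) = x := by
        rw [hx]; push_cast [show 1 ≤ Fintype.card β by omega]; ring
      rw [← this]
      exact_mod_cast h1
    have h3 : avoiding (insert e S) = (avoiding S).filter fun σ => ¬ Realises σ e := by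
      ext σ
      simp [avoiding, and_comm]
    have h4 := Finset.card_filter_add_card_filter_not (s := avoiding S) (fun σ => Realises σ e)
    rw [← h3] at h4
    have h4' : (((avoiding S).filter fun σ => Realises σ e).card : ℝ) +
      (avoiding (insert e S)).card = (avoiding S).card := by exact_mod_cast h4
    rw [Finset.card_insert_of_notMem he, pow_succ]
    have h5 : (((avoiding S).filter fun σ => Realises σ e).card : ℝ) ≤
        2 / x * (avoiding S).card := by
      rw [div_mul_eq_mul_div, le_div_iff₀ (by linarith)]; linarith
    have h6 : 0 ≤ 1 - 2 / x := by
      rw [sub_nonneg, div_le_one (by linarith)]; exact hx2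
    calc _ = (1 - 2 / x) * ((1 - 2 / x) ^ S.card * (Fintype.card (α ≃ β) : ℝ)) := by ring
      _ ≤ (1 - 2 / x) * (avoiding S).card := by gcongr
      _ ≤ _ := by linarith

theorem card_union_four_le {τ : Type*} [DecidableEq τ] {A B C D : Finset τ} {x : ℕ}
    (hA : A.card ≤ x) (hB : B.card ≤ x) (hC : C.card ≤ x) (hD : D.card ≤ x) :
    (A ∪ B ∪ (C ∪ D)).card ≤ 4 * x := by
  have := Finset.card_union_le (A ∪ B) (C ∪ D)
  have := Finset.card_union_le A B
  have := Finset.card_union_le C D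
  omega

theorem card_touches_le [DecidableEq ι] [DecidableEq κ] (ρ : α → ι) (γ : β → κ) (a b : ℕ)
    (ha : ∀ s, (Finset.univ.filter fun t => ρ t = ρ s).card ≤ a)
    (hb : ∀ s, (Finset.univ.filter fun t => γ t = γ s).card ≤ b) (e : (α × α) × (β × β)) :
    ((fiberPairs ρ ×ˢ fiberPairs γ).filter (Touches e)).card ≤
      4 * ((a - 1) * (fiberPairs γ).card + (b - 1) * (fiberPairs ρ).card) := by
  have hsub : (fiberPairs ρ ×ˢ fiberPairs γ).filter (Touches e) ⊆
      (((fiberPairs ρ).filter (fun p => p.1 = e.1.1) ∪ (fiberPairs ρ).filter (fun p => p.1 = e.1.2) ∪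
        ((fiberPairs ρ).filter (fun p => p.2 = e.1.1) ∪
          (fiberPairs ρ).filter (fun p => p.2 = e.1.2))) ×ˢ fiberPairs γ) ∪
      (fiberPairs ρ ×ˢ ((fiberPairs γ).filter (fun p => p.1 = e.2.1) ∪
        (fiberPairs γ).filter (fun p => p.1 = e.2.2) ∪
        ((fiberPairs γ).filter (fun p => p.2 = e.2.1) ∪
          (fiberPairs γ).filter (fun p => p.2 = e.2.2)))) := by
    intro f hf
    simp only [Finset.mem_filter, Finset.mem_product, Touches, Finset.mem_union] at hf ⊢
    tauto
  refine (Finset.card_le_card hsub).trans ((Finset.card_union_le _ _).trans ?_)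
  rw [Finset.card_product, Finset.card_product]
  have fa : ∀ s, ((fiberPairs ρ).filter fun p => p.1 = s).card ≤ a - 1 := fun s =>
    (card_filter_fiberPairs_fst_le ρ s).trans (Nat.sub_le_sub_right (ha s) 1)
  have fa' : ∀ s, ((fiberPairs ρ).filter fun p => p.2 = s).card ≤ a - 1 := fun s =>
    (card_filter_fiberPairs_snd_le ρ s).trans (Nat.sub_le_sub_right (ha s) 1)
  have fb : ∀ s, ((fiberPairs γ).filter fun p => p.1 = s).card ≤ b - 1 := fun s =>
    (card_filter_fiberPairs_fst_le γ s).trans (Nat.sub_le_sub_right (hb s) 1)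
  have fb' : ∀ s, ((fiberPairs γ).filter fun p => p.2 = s).card ≤ b - 1 := fun s =>
    (card_filter_fiberPairs_snd_le γ s).trans (Nat.sub_le_sub_right (hb s) 1)
  calc _ ≤ 4 * (a - 1) * (fiberPairs γ).card + (fiberPairs ρ).card * (4 * (b - 1)) := by
        gcongr
        · exact card_union_four_le (fa _) (fa _) (fa' _) (fa' _)
        · exact card_union_four_le (fb _) (fb _) (fb' _) (fb' _)
    _ = _ := by ring

/-- Lower bound for light margins, from the local lemma. -/
theorem le_card_isSimpleMatching [DecidableEq ι] [DecidableEq κ] (ρ : α → ι) (γ : β → κ) (a b : ℕ)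
    (ha : ∀ s, (Finset.univ.filter fun t => ρ t = ρ s).card ≤ a)
    (hb : ∀ s, (Finset.univ.filter fun t => γ t = γ s).card ≤ b) (hN : 2 ≤ Fintype.card β)
    (hD : 16 * ((a - 1) * (fiberPairs γ).card + (b - 1) * (fiberPairs ρ).card) ≤
      Fintype.card β * (Fintype.card β - 1)) :
    (1 - 2 / ((Fintype.card β : ℝ) * (Fintype.card β - 1))) ^
        ((fiberPairs ρ).card * (fiberPairs γ).card) * (Fintype.card (α ≃ β) : ℝ)
      ≤ (Finset.univ.filter (IsSimpleMatching ρ γ)).card := by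
  have := le_card_avoiding (fiberPairs ρ ×ˢ fiberPairs γ) (by
      intro e he
      simp only [Finset.mem_product, fiberPairs, Finset.mem_filter] at he
      exact ⟨he.1.2.1, he.2.2.1⟩) _ (fun e _ => card_touches_le ρ γ a b ha hb e)
      (by linarith) hN _ subset_rfl
  rw [Finset.card_product] at this
  refine this.trans (le_of_eq ?_)
  congr 2
  ext σ
  simp only [avoiding, Finset.mem_filter, isSimpleMatching_iff]

end Counting

/-! ### The second moment of the number of collisions -/

section SecondMoment

variable {α β ι κ : Type*} [Fintype α] [Fintype β] [DecidableEq α] [DecidableEq β]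

/-- The pairs of distinct tokens of one row which `σ` matches into one column. -/
def collisions [DecidableEq ι] [DecidableEq κ] (ρ : α → ι) (γ : β → κ) (σ : α ≃ β) :
    Finset (α × α) :=
  (fiberPairs ρ).filter fun p => (σ p.1, σ p.2) ∈ fiberPairs γ

theorem isSimpleMatching_iff_collisions [DecidableEq ι] [DecidableEq κ] (ρ : α → ι) (γ : β → κ)
    (σ : α ≃ β) : IsSimpleMatching ρ γ σ ↔ (collisions ρ γ σ).card = 0 := by
  rw [Finset.card_eq_zero, collisions, Finset.filter_eq_empty_iff]
  constructor
  · rintro h ⟨s, t⟩ hp hq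
    simp only [fiberPairs, Finset.mem_filter, Finset.mem_univ, true_and] at hp hq
    exact hp.1 (h s t hp.2 hq.2)
  · intro h s t h1 h2
    by_contra h3
    exact h (x := (s, t)) (by simp [fiberPairs, h1, h3]) (by simp [fiberPairs, h2, h3])

/-- The triples of distinct tokens lying in a common fiber of `ρ`. -/
def fiberTriples [DecidableEq ι] (ρ : α → ι) : Finset (α × α × α) :=
  Finset.univ.filter fun p => (p.1, p.2.1) ∈ fiberPairs ρ ∧ (p.1, p.2.2) ∈ fiberPairs ρ ∧
    p.2.1 ≠ p.2.2

theorem card_fiberTriples_le [DecidableEq ι] (ρ : α → ι) (a : ℕ)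
    (ha : ∀ s, (Finset.univ.filter fun t => ρ t = ρ s).card ≤ a) :
    (fiberTriples ρ).card ≤ a * (fiberPairs ρ).card := by
  rw [Finset.card_eq_sum_card_fiberwise (f := fun p => (p.1, p.2.1)) (t := fiberPairs ρ)
    (by intro p hp; simp only [fiberTriples, Finset.coe_filter] at hp; exact hp.2.1)]
  refine (Finset.sum_le_card_nsmul _ _ a ?_).trans (by rw [smul_eq_mul, mul_comm])
  rintro ⟨s, t⟩ _
  refine le_trans ?_ (ha s)
  refine Finset.card_le_card_of_injOn (fun p => p.2.2) ?_ ?_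
  · rintro ⟨x, y, z⟩ h
    simp only [fiberTriples, fiberPairs, Finset.mem_coe, Finset.mem_filter, Finset.mem_univ,
      true_and, Prod.mk.injEq] at h ⊢
    obtain ⟨h, rfl, rfl⟩ := h
    exact h.2.1.2.symm
  · rintro ⟨x, y, z⟩ h ⟨x', y', z'⟩ h' hz
    simp only [Finset.mem_coe, Finset.mem_filter, Prod.mk.injEq] at h h' hz
    simp [h.2.1, h.2.2, h'.2.1, h'.2.2, hz]

/-- The pairs of disjoint members of `fiberPairs ρ`. -/
def disjointFiberPairs [DecidableEq ι] (ρ : α → ι) : Finset ((α × α) × (α × α)) :=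
  (fiberPairs ρ ×ˢ fiberPairs ρ).filter fun p => p.1.1 ≠ p.2.1 ∧ p.1.1 ≠ p.2.2 ∧
    p.1.2 ≠ p.2.1 ∧ p.1.2 ≠ p.2.2

theorem card_disjointFiberPairs_le [DecidableEq ι] (ρ : α → ι) :
    (disjointFiberPairs ρ).card ≤ (fiberPairs ρ).card ^ 2 := by
  rw [sq, ← Finset.card_product]
  exact Finset.card_filter_le _ _

theorem sum_card_filter_eq {Ω τ τ' : Type*} [Fintype Ω] [DecidableEq τ'] (X : Finset τ)
    (Z : Finset τ') (g : Ω → τ → τ') :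
    ∑ σ, (X.filter fun p => g σ p ∈ Z).card =
      ∑ p ∈ X, ∑ q ∈ Z, (Finset.univ.filter fun σ => g σ p = q).card := by
  simp only [Finset.card_filter]
  rw [Finset.sum_comm]
  refine Finset.sum_congr rfl fun p _ => ?_
  rw [Finset.sum_comm]
  refine Finset.sum_congr rfl fun σ _ => ?_
  rw [Finset.sum_ite_eq]

/-- Linearity of expectation over `k`-tuples of distinct tokens, whose entries are enumerated by `x`
and `z`: a random matching sends `|X| |Z| / (N (N - 1) ⋯ (N - k + 1))` tuples of `X` into `Z` on
average. -/
theorem sum_card_filter_mul_descFactorial {τ τ' : Type*} [DecidableEq τ'] {k : ℕ}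
    (h : Fintype.card α = Fintype.card β) (X : Finset τ) (Z : Finset τ') (x : τ → Fin k → α)
    (z : τ' → Fin k → β) (hX : ∀ p ∈ X, (x p).Injective) (hZ : ∀ q ∈ Z, (z q).Injective)
    (g : (α ≃ β) → τ → τ') (hg : ∀ σ p q, g σ p = q ↔ ∀ i, σ (x p i) = z q i) :
    (∑ σ, (X.filter fun p => g σ p ∈ Z).card) * (Fintype.card α).descFactorial k =
      X.card * Z.card * (Fintype.card α).factorial := by
  rw [sum_card_filter_eq]
  simp only [hg, Finset.sum_mul]
  rw [Finset.sum_congr rfl fun p hp => Finset.sum_congr rfl fun q hq =>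
    card_equiv_extending h (x p) (z q) (hX p hp) (hZ q hq)]
  simp only [Finset.sum_const, smul_eq_mul]
  ring

theorem injective_of_mem_fiberPairs [DecidableEq ι] {ρ : α → ι} {p : α × α}
    (hp : p ∈ fiberPairs ρ) : Function.Injective ![p.1, p.2] := by
  obtain ⟨x, y⟩ := p
  intro i j hij
  simp only [fiberPairs, Finset.mem_filter, Finset.mem_univ, true_and] at hp
  fin_cases i <;> fin_cases j <;> simp_all

theorem injective_of_mem_fiberTriples [DecidableEq ι] {ρ : α → ι} {p : α × α × α}
    (hp : p ∈ fiberTriples ρ) : Function.Injective ![p.1, p.2.1, p.2.2] := by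
  obtain ⟨x, y, z⟩ := p
  intro i j hij
  simp only [fiberTriples, fiberPairs, Finset.mem_filter, Finset.mem_univ, true_and] at hp
  fin_cases i <;> fin_cases j <;> simp_all

theorem injective_of_mem_disjointFiberPairs [DecidableEq ι] {ρ : α → ι} {p : (α × α) × (α × α)}
    (hp : p ∈ disjointFiberPairs ρ) : Function.Injective ![p.1.1, p.1.2, p.2.1, p.2.2] := by
  obtain ⟨⟨x, y⟩, ⟨z, w⟩⟩ := p
  intro i j hij
  simp only [disjointFiberPairs, fiberPairs, Finset.mem_filter, Finset.mem_product,
    Finset.mem_univ, true_and] at hp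
  fin_cases i <;> fin_cases j <;> simp_all

theorem sum_card_collisions [DecidableEq ι] [DecidableEq κ] (h : Fintype.card α = Fintype.card β)
    (ρ : α → ι) (γ : β → κ) :
    (∑ σ, (collisions ρ γ σ).card) * (Fintype.card α).descFactorial 2 =
      (fiberPairs ρ).card * (fiberPairs γ).card * (Fintype.card α).factorial := by
  refine sum_card_filter_mul_descFactorial h (fiberPairs ρ) (fiberPairs γ)
    (fun p => ![p.1, p.2]) (fun p => ![p.1, p.2])
    (fun p hp => injective_of_mem_fiberPairs hp) (fun p hp => injective_of_mem_fiberPairs hp)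
    (fun σ p => (σ p.1, σ p.2)) ?_
  rintro σ ⟨a, b⟩ ⟨c, d⟩
  simp [Fin.forall_fin_two]

theorem sum_card_triple_collisions [DecidableEq ι] [DecidableEq κ]
    (h : Fintype.card α = Fintype.card β) (ρ : α → ι) (γ : β → κ) :
    (∑ σ : α ≃ β, ((fiberTriples ρ).filter fun p =>
      (σ p.1, σ p.2.1, σ p.2.2) ∈ fiberTriples γ).card) * (Fintype.card α).descFactorial 3 =
      (fiberTriples ρ).card * (fiberTriples γ).card * (Fintype.card α).factorial := by
  refine sum_card_filter_mul_descFactorial h _ _ (fun p => ![p.1, p.2.1, p.2.2])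
    (fun p => ![p.1, p.2.1, p.2.2])
    (fun p hp => injective_of_mem_fiberTriples hp) (fun p hp => injective_of_mem_fiberTriples hp)
    (fun σ p => (σ p.1, σ p.2.1, σ p.2.2)) ?_
  rintro σ ⟨a, b, c⟩ ⟨a', b', c'⟩
  simp [Fin.forall_fin_succ]

theorem sum_card_disjoint_collisions [DecidableEq ι] [DecidableEq κ]
    (h : Fintype.card α = Fintype.card β) (ρ : α → ι) (γ : β → κ) :
    (∑ σ : α ≃ β, ((disjointFiberPairs ρ).filter fun p =>
      ((σ p.1.1, σ p.1.2), (σ p.2.1, σ p.2.2)) ∈ disjointFiberPairs γ).card) *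
        (Fintype.card α).descFactorial 4 =
      (disjointFiberPairs ρ).card * (disjointFiberPairs γ).card *
        (Fintype.card α).factorial := by
  refine sum_card_filter_mul_descFactorial h _ _ (fun p => ![p.1.1, p.1.2, p.2.1, p.2.2])
    (fun p => ![p.1.1, p.1.2, p.2.1, p.2.2])
    (fun p hp => injective_of_mem_disjointFiberPairs hp)
    (fun p hp => injective_of_mem_disjointFiberPairs hp)
    (fun σ p => ((σ p.1.1, σ p.1.2), (σ p.2.1, σ p.2.2))) ?_
  rintro σ ⟨⟨a, b⟩, ⟨c, d⟩⟩ ⟨⟨a', b'⟩, ⟨c', d'⟩⟩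
  simp [Fin.forall_fin_succ, and_assoc]

/-- Two collisions are disjoint, or they share a token; in the latter case they form a triple of
tokens with a distinguished member, up to the four choices of which members coincide. -/
theorem card_collisions_sq_le [DecidableEq ι] [DecidableEq κ] (ρ : α → ι) (γ : β → κ) (σ : α ≃ β) :
    (collisions ρ γ σ).card ^ 2 ≤
      ((disjointFiberPairs ρ).filter fun p =>
        ((σ p.1.1, σ p.1.2), (σ p.2.1, σ p.2.2)) ∈ disjointFiberPairs γ).card +
      4 * ((collisions ρ γ σ).card + ((fiberTriples ρ).filter fun p =>
        (σ p.1, σ p.2.1, σ p.2.2) ∈ fiberTriples γ).card) := by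
  set A := collisions ρ γ σ with hA
  set D := (disjointFiberPairs ρ).filter fun p =>
        ((σ p.1.1, σ p.1.2), (σ p.2.1, σ p.2.2)) ∈ disjointFiberPairs γ
  set T := (fiberTriples ρ).filter fun p => (σ p.1, σ p.2.1, σ p.2.2) ∈ fiberTriples γ
  have memA : ∀ x y, (x, y) ∈ A ↔ x ≠ y ∧ ρ x = ρ y ∧ γ (σ x) = γ (σ y) := by
    intro x y
    simp only [A, collisions, fiberPairs, Finset.mem_filter, Finset.mem_univ, true_and, ne_eq,
      EmbeddingLike.apply_eq_iff_eq]
    tauto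
  -- pairs of collisions with a common token `x`
  let B : Finset (α × α × α) := Finset.univ.filter fun p => (p.1, p.2.1) ∈ A ∧ (p.1, p.2.2) ∈ A
  have memB : ∀ x y z, (x, y, z) ∈ B ↔ (x, y) ∈ A ∧ (x, z) ∈ A := by
    intro x y z; simp [B]
  have hB : B.card ≤ A.card + T.card := by
    have : B ⊆ A.image (fun p => (p.1, p.2, p.2)) ∪ T := by
      rintro ⟨x, y, z⟩ h
      rw [memB] at h
      by_cases hyz : y = z
      · subst hyz
        exact Finset.mem_union_left _ (Finset.mem_image.2 ⟨(x, y), h.1, rfl⟩)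
      · refine Finset.mem_union_right _ ?_
        simp only [memA] at h
        simp only [T, fiberTriples, fiberPairs, Finset.mem_filter, Finset.mem_univ, true_and, ne_eq,
          EmbeddingLike.apply_eq_iff_eq]
        tauto
    exact (Finset.card_le_card this).trans ((Finset.card_union_le _ _).trans
      (Nat.add_le_add_right Finset.card_image_le _))
  have hsub : A ×ˢ A ⊆ D ∪
      ((B.image (fun p => ((p.1, p.2.1), (p.1, p.2.2))) ∪
        B.image (fun p => ((p.1, p.2.1), (p.2.2, p.1)))) ∪
       (B.image (fun p => ((p.2.1, p.1), (p.1, p.2.2))) ∪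
        B.image (fun p => ((p.2.1, p.1), (p.2.2, p.1))))) := by
    rintro ⟨⟨x, y⟩, ⟨z, w⟩⟩ h
    rw [Finset.mem_product] at h
    simp only at h
    have symm : ∀ {x y}, (x, y) ∈ A → (y, x) ∈ A := by
      intro x y hxy
      rw [memA] at hxy ⊢
      exact ⟨hxy.1.symm, hxy.2.1.symm, hxy.2.2.symm⟩
    by_cases h1 : x = z
    · subst h1
      refine Finset.mem_union_right _ (Finset.mem_union_left _ (Finset.mem_union_left _ ?_))
      exact Finset.mem_image.2 ⟨(x, y, w), (memB _ _ _).2 h, rfl⟩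
    by_cases h2 : x = w
    · subst h2
      refine Finset.mem_union_right _ (Finset.mem_union_left _ (Finset.mem_union_right _ ?_))
      exact Finset.mem_image.2 ⟨(x, y, z), (memB _ _ _).2 ⟨h.1, symm h.2⟩, rfl⟩
    by_cases h3 : y = z
    · subst h3
      refine Finset.mem_union_right _ (Finset.mem_union_right _ (Finset.mem_union_left _ ?_))
      exact Finset.mem_image.2 ⟨(y, x, w), (memB _ _ _).2 ⟨symm h.1, h.2⟩, rfl⟩
    by_cases h4 : y = w
    · subst h4
      refine Finset.mem_union_right _ (Finset.mem_union_right _ (Finset.mem_union_right _ ?_))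
      exact Finset.mem_image.2 ⟨(y, x, z), (memB _ _ _).2 ⟨symm h.1, symm h.2⟩, rfl⟩
    · refine Finset.mem_union_left _ ?_
      simp only [memA] at h
      simp only [D, disjointFiberPairs, fiberPairs, Finset.mem_filter, Finset.mem_univ, true_and,
        ne_eq, EmbeddingLike.apply_eq_iff_eq, Finset.mem_product]
      tauto
  have h0 := Finset.card_le_card hsub
  rw [Finset.card_product, ← sq] at h0
  have i1 := Finset.card_image_le (s := B) (f := fun p => ((p.1, p.2.1), (p.1, p.2.2)))
  have i2 := Finset.card_image_le (s := B) (f := fun p => ((p.1, p.2.1), (p.2.2, p.1)))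
  have i3 := Finset.card_image_le (s := B) (f := fun p => ((p.2.1, p.1), (p.1, p.2.2)))
  have i4 := Finset.card_image_le (s := B) (f := fun p => ((p.2.1, p.1), (p.2.2, p.1)))
  refine h0.trans ((Finset.card_union_le _ _).trans (Nat.add_le_add_left ?_ _))
  refine (Finset.card_union_le _ _).trans ((Nat.add_le_add (Finset.card_union_le _ _)
    (Finset.card_union_le _ _)).trans ?_)
  omega

/-- The elementary estimate that closes the second moment argument. Here `M = N (N - 1)`, `w / M`
is the mean number of collisions and `(a b)² ≤ 4 w` bounds the sizes of the fibers. -/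
theorem second_moment_estimate {N w ab M Q T : ℝ} (hN : 6 ≤ N) (hM : M = N * (N - 1)) (hw : 0 < w)
    (habw : ab ^ 2 ≤ 4 * w) (hQ : Q = M * ((N - 2) * (N - 3)))
    (hT : T = M * (N - 2)) :
    (w ^ 2 / Q + 4 * (w / M + ab * w / T)) / (w / M) ^ 2 - 1 ≤
      12 / N + 4 / (w / M) + 16 / √(w / M) := by
  have hMpos : 0 < M := by rw [hM]; nlinarith
  have hμ : 0 < w / M := by positivity
  have hs : 0 < √(w / M) := Real.sqrt_pos.2 hμ
  have h23 : 0 < (N - 2) * (N - 3) := by nlinarith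
  have e : (w ^ 2 / Q + 4 * (w / M + ab * w / T)) / (w / M) ^ 2 - 1 =
      (M / ((N - 2) * (N - 3)) - 1) + 4 / (w / M) + 4 * (ab / (N - 2)) / (w / M) := by
    have : N - 2 ≠ 0 := by linarith
    have : N - 3 ≠ 0 := by linarith
    rw [hQ, hT]
    field_simp
    ring
  rw [e]
  have h1 : M / ((N - 2) * (N - 3)) - 1 ≤ 12 / N := by
    rw [sub_le_iff_le_add, div_le_iff₀ h23, hM]
    have : (12 / N + 1) * ((N - 2) * (N - 3)) - N * (N - 1) =
        (12 * ((N - 2) * (N - 3)) + N * (6 - 4 * N)) / N := by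
      field_simp
      ring
    have h2 : 0 ≤ (12 * ((N - 2) * (N - 3)) + N * (6 - 4 * N)) / N := by
      apply div_nonneg <;> nlinarith
    linarith
  have h2 : 4 * (ab / (N - 2)) / (w / M) ≤ 16 / √(w / M) := by
    have hab' : ab ≤ 2 * √w := by
      refine abs_le_of_sq_le_sq' ?_ (by positivity) |>.2
      rw [mul_pow, Real.sq_sqrt hw.le]; linarith
    have hN2 : √M / 2 ≤ N - 2 := by
      have : √M ≤ N := by
        rw [Real.sqrt_le_left (by linarith), hM]; nlinarith
      linarith
    have hsM : 0 < √M := Real.sqrt_pos.2 hMpos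
    have h3 : ab / (N - 2) ≤ 4 * √(w / M) := by
      rw [Real.sqrt_div hw.le, div_le_iff₀ (by linarith)]
      calc ab ≤ 2 * √w := hab'
        _ = 4 * (√w / √M) * (√M / 2) := by field_simp; ring
        _ ≤ _ := by gcongr
    calc 4 * (ab / (N - 2)) / (w / M) ≤ 4 * (4 * √(w / M)) / (w / M) := by gcongr
      _ = 16 / √(w / M) := by
        nth_rewrite 2 [← Real.mul_self_sqrt hμ.le]
        field_simp
        ring
  linarith

/-- Upper bound by the second moment method: if the mean number of collisions is large, then simple
matchings are rare. -/
theorem card_isSimpleMatching_le [DecidableEq ι] [DecidableEq κ]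
    (h : Fintype.card α = Fintype.card β) (ρ : α → ι) (γ : β → κ) (a b : ℕ)
    (ha : ∀ s, (Finset.univ.filter fun t => ρ t = ρ s).card ≤ a)
    (hb : ∀ s, (Finset.univ.filter fun t => γ t = γ s).card ≤ b)
    (ha2 : a ^ 2 ≤ 2 * (fiberPairs ρ).card) (hb2 : b ^ 2 ≤ 2 * (fiberPairs γ).card)
    (N w μ : ℝ) (hN : N = Fintype.card α) (hN6 : 6 ≤ N)
    (hw : w = (fiberPairs ρ).card * (fiberPairs γ).card) (hwpos : 0 < w)
    (hμ : μ = w / (N * (N - 1))) :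
    ((Finset.univ.filter (IsSimpleMatching ρ γ)).card : ℝ) ≤
      (12 / N + 4 / μ + 16 / √μ) * (Fintype.card (α ≃ β) : ℝ) := by
  set F : ℝ := (Fintype.card (α ≃ β) : ℝ) with hF
  have hF' : ((Fintype.card α).factorial : ℝ) = F := by
    rw [hF, Fintype.card_equiv (Fintype.equivOfCardEq h)]
  have hFpos : 0 < F := by rw [← hF']; exact_mod_cast Nat.factorial_pos _
  set M : ℝ := N * (N - 1) with hM
  have hMpos : 0 < M := by rw [hM]; nlinarith
  have hμpos : 0 < μ := by rw [hμ]; positivity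
  have hN6' : 6 ≤ Fintype.card α := by rw [hN] at hN6; exact_mod_cast hN6
  have d1 : ((Fintype.card α - 1 : ℕ) : ℝ) = N - 1 := by
    rw [hN, Nat.cast_sub (by omega)]; simp
  have d2 : ((Fintype.card α - 2 : ℕ) : ℝ) = N - 2 := by
    rw [hN, Nat.cast_sub (by omega)]; simp
  have d3 : ((Fintype.card α - 3 : ℕ) : ℝ) = N - 3 := by
    rw [hN, Nat.cast_sub (by omega)]; simp
  have f2 : ((Fintype.card α).descFactorial 2 : ℝ) = M := by
    simp only [Nat.descFactorial, Nat.cast_mul, d1, Nat.sub_zero, ← hN, Nat.cast_one]; ring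
  have f3 : ((Fintype.card α).descFactorial 3 : ℝ) = M * (N - 2) := by
    simp only [Nat.descFactorial, Nat.cast_mul, d1, d2, Nat.sub_zero, ← hN, Nat.cast_one]; ring
  have f4 : ((Fintype.card α).descFactorial 4 : ℝ) = M * ((N - 2) * (N - 3)) := by
    simp only [Nat.descFactorial, Nat.cast_mul, d1, d2, d3, Nat.sub_zero, ← hN, Nat.cast_one]; ring
  set Y : (α ≃ β) → ℝ := fun σ => (collisions ρ γ σ).card with hY
  -- the first moment
  have m1 : ∑ σ, Y σ = μ * F := by
    have := congrArg (Nat.cast : ℕ → ℝ) (sum_card_collisions h ρ γ)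
    push_cast at this
    rw [f2, ← hw, hF'] at this
    rw [hμ, div_mul_eq_mul_div, eq_div_iff hMpos.ne']
    exact this
  -- the second moment
  have hT : 0 < M * (N - 2) := mul_pos hMpos (by linarith)
  have hQ : 0 < M * ((N - 2) * (N - 3)) := mul_pos hMpos (by nlinarith)
  have m3 : (∑ σ : α ≃ β, (((fiberTriples ρ).filter fun p =>
      (σ p.1, σ p.2.1, σ p.2.2) ∈ fiberTriples γ).card : ℝ)) ≤
      ((a * b : ℕ) : ℝ) * w / (M * (N - 2)) * F := by
    have := congrArg (Nat.cast : ℕ → ℝ) (sum_card_triple_collisions h ρ γ)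
    push_cast at this
    rw [f3, hF'] at this
    rw [div_mul_eq_mul_div, le_div_iff₀ hT, this]
    refine mul_le_mul_of_nonneg_right ?_ hFpos.le
    have h1 : ((fiberTriples ρ).card : ℝ) ≤ a * (fiberPairs ρ).card := by
      exact_mod_cast card_fiberTriples_le ρ a ha
    have h2 : ((fiberTriples γ).card : ℝ) ≤ b * (fiberPairs γ).card := by
      exact_mod_cast card_fiberTriples_le γ b hb
    calc _ ≤ (a * (fiberPairs ρ).card : ℝ) * (b * (fiberPairs γ).card) := by gcongr
      _ = _ := by rw [hw]; push_cast; ring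
  have m4 : (∑ σ : α ≃ β, (((disjointFiberPairs ρ).filter fun p =>
      ((σ p.1.1, σ p.1.2), (σ p.2.1, σ p.2.2)) ∈ disjointFiberPairs γ).card : ℝ)) ≤
      w ^ 2 / (M * ((N - 2) * (N - 3))) * F := by
    have := congrArg (Nat.cast : ℕ → ℝ) (sum_card_disjoint_collisions h ρ γ)
    push_cast at this
    rw [f4, hF'] at this
    rw [div_mul_eq_mul_div, le_div_iff₀ hQ, this]
    gcongr
    have h1 : ((disjointFiberPairs ρ).card : ℝ) ≤ (fiberPairs ρ).card ^ 2 := by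
      exact_mod_cast card_disjointFiberPairs_le ρ
    have h2 : ((disjointFiberPairs γ).card : ℝ) ≤ (fiberPairs γ).card ^ 2 := by
      exact_mod_cast card_disjointFiberPairs_le γ
    calc _ ≤ ((fiberPairs ρ).card ^ 2 : ℝ) * (fiberPairs γ).card ^ 2 := by gcongr
      _ = _ := by rw [hw]; ring
  set V : ℝ := w ^ 2 / (M * ((N - 2) * (N - 3))) +
    4 * (w / M + ((a * b : ℕ) : ℝ) * w / (M * (N - 2))) with hV
  have m2 : ∑ σ, Y σ ^ 2 ≤ V * F := by
    calc ∑ σ, Y σ ^ 2 ≤ ∑ σ : α ≃ β, ((((disjointFiberPairs ρ).filter fun p =>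
          ((σ p.1.1, σ p.1.2), (σ p.2.1, σ p.2.2)) ∈ disjointFiberPairs γ).card : ℝ) +
          4 * (Y σ + ((fiberTriples ρ).filter fun p =>
            (σ p.1, σ p.2.1, σ p.2.2) ∈ fiberTriples γ).card)) := by
          refine Finset.sum_le_sum fun σ _ => ?_
          simp only [hY]
          exact_mod_cast card_collisions_sq_le ρ γ σ
      _ ≤ _ := by
          rw [Finset.sum_add_distrib, ← Finset.mul_sum, Finset.sum_add_distrib, m1, hV, ← hμ]
          linarith
  have est := second_moment_estimate (N := N) (w := w) (ab := ((a * b : ℕ) : ℝ)) hN6 hM hwpos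
    (by
      have : (a * b) ^ 2 ≤ 4 * ((fiberPairs ρ).card * (fiberPairs γ).card) := by
        calc (a * b) ^ 2 = a ^ 2 * b ^ 2 := by ring
          _ ≤ (2 * (fiberPairs ρ).card) * (2 * (fiberPairs γ).card) := Nat.mul_le_mul ha2 hb2
          _ = _ := by ring
      rw [hw]; exact_mod_cast this) rfl rfl
  rw [← hV, ← hμ] at est
  -- Chebyshev's inequality
  set P : ℝ := ((Finset.univ.filter (IsSimpleMatching ρ γ)).card : ℝ) with hP
  have cheb : P * μ ^ 2 ≤ ∑ σ, (Y σ - μ) ^ 2 := by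
    calc P * μ ^ 2 = ∑ σ ∈ Finset.univ.filter (IsSimpleMatching ρ γ), (Y σ - μ) ^ 2 := by
          rw [hP, ← nsmul_eq_mul, ← Finset.sum_const]
          refine Finset.sum_congr rfl fun σ hσ => ?_
          have := (isSimpleMatching_iff_collisions ρ γ σ).1 (Finset.mem_filter.1 hσ).2
          simp [hY, this]
      _ ≤ _ := Finset.sum_le_sum_of_subset_of_nonneg (Finset.filter_subset _ _)
          (fun _ _ _ => sq_nonneg _)
  have expand : ∑ σ, (Y σ - μ) ^ 2 = ∑ σ, Y σ ^ 2 - μ ^ 2 * F := by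
    have : ∀ σ, (Y σ - μ) ^ 2 = Y σ ^ 2 - 2 * μ * Y σ + μ ^ 2 := fun σ => by ring
    simp only [this]
    rw [Finset.sum_add_distrib, Finset.sum_sub_distrib, ← Finset.mul_sum, m1, Finset.sum_const,
      Finset.card_univ, nsmul_eq_mul, ← hF]
    ring
  have fin : P * μ ^ 2 ≤ (V / μ ^ 2 - 1) * F * μ ^ 2 := by
    have : (V / μ ^ 2 - 1) * F * μ ^ 2 = V * F - μ ^ 2 * F := by field_simp
    rw [this]; linarith
  calc P ≤ (V / μ ^ 2 - 1) * F := le_of_mul_le_mul_right fin (by positivity)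
    _ ≤ _ := by gcongr

end SecondMoment

/-! ### Sequential exposure and the pigeonhole bound -/

section Sequential

variable {α β ι κ : Type*} [Fintype α] [Fintype β] [DecidableEq α] [DecidableEq β]
  [DecidableEq ι] [DecidableEq κ]

/-- The matchings without a collision among the column tokens of `U`. -/
def simpleOn (ρ : α → ι) (γ : β → κ) (U : Finset β) : Finset (α ≃ β) :=
  Finset.univ.filter fun σ => ∀ u ∈ U, ∀ v ∈ U, u ≠ v → γ u = γ v → ρ (σ.symm u) ≠ ρ (σ.symm v)

theorem mem_simpleOn {ρ : α → ι} {γ : β → κ} {U : Finset β} {σ : α ≃ β} : σ ∈ simpleOn ρ γ U ↔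
    ∀ u ∈ U, ∀ v ∈ U, u ≠ v → γ u = γ v → ρ (σ.symm u) ≠ ρ (σ.symm v) := by
  simp [simpleOn]

/-- Exposing the partner of one more column token `u`: a transposition gives `u` any partner which
is not yet taken and whose row is not yet used by the column of `u`. -/
theorem card_simpleOn_insert (ρ : α → ι) (γ : β → κ) (b L K : ℕ)
    (hb : ∀ s, (Finset.univ.filter fun t => γ t = γ s).card ≤ b)
    (hL : ∀ F : Finset ι, F.card < b → L ≤ (Finset.univ.filter fun a => ρ a ∉ F).card)
    (U : Finset β) (hU : U.card ≤ K) (u : β) (hu : u ∉ U) :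
    (simpleOn ρ γ U).card * (L - K) ≤ (simpleOn ρ γ (insert u U)).card * Fintype.card α := by
  -- `F σ` are the rows used by the column of `u`, `P σ` the admissible partners of `u`
  let F : (α ≃ β) → Finset ι := fun σ => (U.filter fun v => γ v = γ u).image fun v => ρ (σ.symm v)
  let P : (α ≃ β) → Finset α := fun σ =>
    (Finset.univ.filter fun a => ρ a ∉ F σ) \ U.image σ.symm
  have hP : ∀ σ, L - K ≤ (P σ).card := by
    intro σ
    have hF : (F σ).card < b := by
      refine lt_of_le_of_lt Finset.card_image_le (lt_of_lt_of_le ?_ (hb u))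
      refine Finset.card_lt_card ((Finset.ssubset_iff_of_subset ?_).2 ⟨u, by simp, by simp [hu]⟩)
      intro v hv
      simp only [Finset.mem_filter, Finset.mem_univ, true_and] at hv ⊢
      exact hv.2
    have h1 := hL _ hF
    have h2 := Finset.le_card_sdiff (U.image σ.symm) (Finset.univ.filter fun a => ρ a ∉ F σ)
    have h3 : (U.image σ.symm).card ≤ U.card := Finset.card_image_le
    exact le_trans (by omega) h2
  calc (simpleOn ρ γ U).card * (L - K) ≤ ∑ σ ∈ simpleOn ρ γ U, (P σ).card := by
        rw [← smul_eq_mul, ← Finset.sum_const]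
        exact Finset.sum_le_sum fun σ _ => hP σ
    _ = ((simpleOn ρ γ U).sigma P).card := (Finset.card_sigma _ _).symm
    _ ≤ (simpleOn ρ γ (insert u U) ×ˢ (Finset.univ : Finset α)).card := by
        refine Finset.card_le_card_of_injOn
          (fun p => ((Equiv.swap (p.1.symm u) p.2).trans p.1, p.1.symm u)) ?_ ?_
        · rintro ⟨σ, a⟩ h
          obtain ⟨hσ, ha⟩ := Finset.mem_sigma.1 (Finset.mem_coe.1 h)
          rw [mem_simpleOn] at hσ
          simp only [P, Finset.mem_sdiff, Finset.mem_filter, Finset.mem_univ, true_and] at ha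
          obtain ⟨ha1, ha2⟩ := ha
          refine Finset.mem_coe.2 (Finset.mem_product.2 ⟨mem_simpleOn.2 ?_, Finset.mem_univ _⟩)
          have e1 : ((Equiv.swap (σ.symm u) a).trans σ).symm u = a := by simp
          have e2 : ∀ v ∈ U, ((Equiv.swap (σ.symm u) a).trans σ).symm v = σ.symm v := by
            intro v hv
            rw [Equiv.symm_trans_apply, Equiv.symm_swap]
            refine Equiv.swap_apply_of_ne_of_ne ?_ ?_
            · intro h
              rw [σ.symm.injective h] at hv
              exact hu hv
            · rintro rfl
              exact ha2 (Finset.mem_image_of_mem _ hv)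
          have e3 : ∀ v ∈ U, γ v = γ u → ρ a ≠ ρ (σ.symm v) := by
            intro v hv hvu hav
            exact ha1 (hav ▸ Finset.mem_image.2 ⟨v, Finset.mem_filter.2 ⟨hv, hvu⟩, rfl⟩)
          intro v hv w hw hvw hγ
          rw [Finset.mem_insert] at hv hw
          rcases hv with rfl | hv <;> rcases hw with rfl | hw
          · exact absurd rfl hvw
          · rw [e1, e2 w hw]
            exact e3 w hw hγ.symm
          · rw [e1, e2 v hv]
            exact (e3 v hv hγ).symm
          · rw [e2 v hv, e2 w hw]
            exact hσ v hv w hw hvw hγ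
        · rintro ⟨σ, a⟩ _ ⟨σ', a'⟩ _ h
          simp only [Prod.mk.injEq] at h
          obtain ⟨h1, h2⟩ := h
          have ha : a = a' := by
            have e : ∀ (σ : α ≃ β) a, ((Equiv.swap (σ.symm u) a).trans σ).symm u = a := by simp
            rw [← e σ a, ← e σ' a', h1]
          subst ha
          rw [h2] at h1
          have hσ : σ = σ' := by
            ext x
            have := congrArg (fun f => f (Equiv.swap (σ'.symm u) a x)) h1
            simpa using this
          rw [hσ]
    _ = _ := by rw [Finset.card_product, Finset.card_univ]

theorem le_card_simpleOn (ρ : α → ι) (γ : β → κ) (b L K : ℕ)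
    (hb : ∀ s, (Finset.univ.filter fun t => γ t = γ s).card ≤ b)
    (hL : ∀ F : Finset ι, F.card < b → L ≤ (Finset.univ.filter fun a => ρ a ∉ F).card)
    (U : Finset β) (hU : U.card ≤ K) :
    (L - K) ^ U.card * Fintype.card (α ≃ β) ≤
      Fintype.card α ^ U.card * (simpleOn ρ γ U).card := by
  induction U using Finset.induction_on with
  | empty => simp [simpleOn, Finset.card_univ]
  | insert u U hu ih =>
    rw [Finset.card_insert_of_notMem hu] at hU ⊢
    have ih := ih (by omega)
    have step := card_simpleOn_insert ρ γ b L K hb hL U (by omega) u hu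
    calc (L - K) ^ (U.card + 1) * Fintype.card (α ≃ β)
        = (L - K) * ((L - K) ^ U.card * Fintype.card (α ≃ β)) := by ring
      _ ≤ (L - K) * (Fintype.card α ^ U.card * (simpleOn ρ γ U).card) := by gcongr
      _ = Fintype.card α ^ U.card * ((simpleOn ρ γ U).card * (L - K)) := by ring
      _ ≤ Fintype.card α ^ U.card * ((simpleOn ρ γ (insert u U)).card * Fintype.card α) := by
        gcongr
      _ = _ := by ring

/-- Lower bound by sequential exposure, for margins with few tokens in columns of size at least two:
`U` consists of these tokens, `L` is the mass that is left after removing fewer than `b` rows. -/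
theorem le_card_isSimpleMatching_of_few (ρ : α → ι) (γ : β → κ) (b L : ℕ)
    (hb : ∀ s, (Finset.univ.filter fun t => γ t = γ s).card ≤ b)
    (hL : ∀ F : Finset ι, F.card < b → L ≤ (Finset.univ.filter fun a => ρ a ∉ F).card)
    (U : Finset β) (hU : ∀ u v, u ≠ v → γ u = γ v → u ∈ U) :
    (L - U.card) ^ U.card * Fintype.card (α ≃ β) ≤
      Fintype.card α ^ U.card * (Finset.univ.filter (IsSimpleMatching ρ γ)).card := by
  refine (le_card_simpleOn ρ γ b L U.card hb hL U le_rfl).trans (Nat.mul_le_mul_left _ ?_)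
  refine Finset.card_le_card fun σ hσ => ?_
  rw [mem_simpleOn] at hσ
  rw [Finset.mem_filter]
  refine ⟨Finset.mem_univ _, fun s t h1 h2 => ?_⟩
  by_contra hst
  have hne : σ s ≠ σ t := fun h => hst (σ.injective h)
  exact hσ _ (hU _ _ hne h2) _ (hU _ _ hne.symm h2.symm) hne h2 (by simpa using h1)

/-- Upper bound by the pigeonhole principle: the tokens `U` of a column cannot all be matched into a
set `F` of fewer than `|U|` rows without a collision. -/
theorem card_isSimpleMatching_le_of_pigeonhole (h : Fintype.card α = Fintype.card β) (ρ : α → ι)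
    (γ : β → κ) (U : Finset β) (hU : ∀ u ∈ U, ∀ v ∈ U, γ u = γ v) (F : Finset ι)
    (hF : F.card < U.card) :
    (Finset.univ.filter (IsSimpleMatching ρ γ)).card * Fintype.card α ≤
      U.card * (Finset.univ.filter fun a => ρ a ∉ F).card * Fintype.card (α ≃ β) := by
  have hsub : Finset.univ.filter (IsSimpleMatching ρ γ) ⊆
      U.biUnion fun u => (Finset.univ.filter fun a => ρ a ∉ F).biUnion fun a =>
        Finset.univ.filter fun σ : α ≃ β => σ a = u := by
    intro σ hσ
    have hσ := (Finset.mem_filter.1 hσ).2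
    have : ∃ u ∈ U, ρ (σ.symm u) ∉ F := by
      by_contra! hc
      obtain ⟨u, hu, v, hv, huv, he⟩ := Finset.exists_ne_map_eq_of_card_lt_of_maps_to hF hc
      exact huv (σ.symm.injective (hσ _ _ he (by simpa using hU u hu v hv)))
    obtain ⟨u, hu, hr⟩ := this
    simp only [Finset.mem_biUnion, Finset.mem_filter, Finset.mem_univ, true_and]
    exact ⟨u, hu, σ.symm u, hr, by simp⟩
  have one : ∀ (a : α) (u : β), (Finset.univ.filter fun σ : α ≃ β => σ a = u).card *
      Fintype.card α = Fintype.card (α ≃ β) := by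
    intro a u
    have := card_equiv_extending h (k := 1) (fun _ => a) (fun _ => u)
      (fun _ _ _ => Subsingleton.elim _ _) (fun _ _ _ => Subsingleton.elim _ _)
    rw [Fintype.card_equiv (Fintype.equivOfCardEq h), ← this]
    simp
  calc _ ≤ (∑ u ∈ U, ∑ a ∈ Finset.univ.filter fun a => ρ a ∉ F,
          (Finset.univ.filter fun σ : α ≃ β => σ a = u).card) * Fintype.card α := by
        refine Nat.mul_le_mul_right _ ((Finset.card_le_card hsub).trans ?_)
        exact Finset.card_biUnion_le.trans (Finset.sum_le_sum fun u _ => Finset.card_biUnion_le)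
    _ = _ := by
        simp only [Finset.sum_mul, one, Finset.sum_const, smul_eq_mul]
        ring

end Sequential

/-! ### Tokens of a vector -/

section Vectors

variable {n : ℕ}

/-- The tokens of a vector `f`: a token knows its index and its label. -/
abbrev Token (f : Fin n → ℕ) : Type := Σ i : Fin n, Fin (f i)

/-- The leading entry of a vector, `0` for the empty vector. -/
def leading (f : Fin n → ℕ) : ℕ := if h : 0 < n then f ⟨0, h⟩ else 0

/-- The number `∑ f i (f i - 1)` of ordered pairs of distinct tokens with a common index. -/
def pairCount (f : Fin n → ℕ) : ℕ := ∑ i, f i * (f i - 1)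

theorem le_leading {f : Fin n → ℕ} (hf : Antitone f) (i : Fin n) : f i ≤ leading f := by
  have h : 0 < n := i.pos
  rw [leading, dif_pos h]
  exact hf (Fin.mk_le_of_le_val (Nat.zero_le _))

theorem card_filter_fst (f : Fin n → ℕ) (p : Fin n → Prop) [DecidablePred p] :
    (Finset.univ.filter fun t : Token f => p t.1).card = ∑ i, if p i then f i else 0 := by
  rw [Finset.card_filter, Fintype.sum_sigma]
  refine Finset.sum_congr rfl fun i _ => ?_
  split_ifs <;> simp

theorem card_filter_fst_eq (f : Fin n → ℕ) (i : Fin n) :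
    (Finset.univ.filter fun t : Token f => t.1 = i).card = f i := by
  rw [card_filter_fst f fun j => j = i]
  simp

theorem card_fiberPairs_token (f : Fin n → ℕ) :
    (fiberPairs (Sigma.fst : Token f → Fin n)).card = pairCount f := by
  rw [card_fiberPairs, pairCount, Fintype.sum_sigma]
  refine Finset.sum_congr rfl fun i _ => ?_
  simp only [card_filter_fst_eq]
  simp

theorem leading_mul_le_pairCount (f : Fin n → ℕ) : leading f * (leading f - 1) ≤ pairCount f := by
  rw [leading]
  split_ifs with h
  · exact Finset.single_le_sum (f := fun i => f i * (f i - 1)) (fun _ _ => Nat.zero_le _)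
      (Finset.mem_univ _)
  · simp

/-- If `pairCount f` is positive, then `leading f ≥ 2`, so `leading f ≤ 2 (leading f - 1)`. -/
theorem sq_leading_le {f : Fin n → ℕ} (hf : Antitone f) (h : 0 < pairCount f) :
    leading f ^ 2 ≤ 2 * pairCount f := by
  have h2 : 2 ≤ leading f := by
    by_contra hlt
    refine h.ne' (Finset.sum_eq_zero fun i _ => ?_)
    have := le_leading hf i
    have : f i = 0 ∨ f i - 1 = 0 := by omega
    simpa using this
  have h3 := leading_mul_le_pairCount f
  obtain ⟨x, hx⟩ := Nat.exists_eq_add_of_le h2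
  rw [hx] at h3 ⊢
  have : 2 + x - 1 = 1 + x := by omega
  rw [this] at h3
  nlinarith

theorem pairCount_le {f : Fin n → ℕ} (hf : Antitone f) :
    pairCount f ≤ (leading f - 1) * ∑ i, f i := by
  rw [pairCount, Finset.mul_sum]
  refine Finset.sum_le_sum fun i _ => ?_
  rw [mul_comm]
  exact Nat.mul_le_mul_right _ (Nat.sub_le_sub_right (le_leading hf i) 1)

/-- The first `k` entries of a non-increasing vector have the largest sum. -/
theorem sum_le_sum_of_card_le {f : Fin n → ℕ} (hf : Antitone f) (k : ℕ) (F : Finset (Fin n))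
    (hF : F.card ≤ k) :
    ∑ i ∈ F, f i ≤ ∑ i ∈ Finset.univ.filter fun i : Fin n => i.val < k, f i := by
  set G := Finset.univ.filter fun i : Fin n => i.val < k with hG
  by_cases hk : k < n
  · have hGc : G.card = k := by
      rw [hG, Fin.card_filter_val_lt]
      omega
    have h1 : ∑ i ∈ F \ G, f i ≤ (F \ G).card • f ⟨k, hk⟩ := by
      refine Finset.sum_le_card_nsmul _ _ _ fun i hi => hf ?_
      simp only [hG, Finset.mem_sdiff, Finset.mem_filter, Finset.mem_univ, true_and, not_lt] at hi
      exact hi.2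
    have h2 : (G \ F).card • f ⟨k, hk⟩ ≤ ∑ i ∈ G \ F, f i := by
      refine Finset.card_nsmul_le_sum _ _ _ fun i hi => hf ?_
      simp only [hG, Finset.mem_sdiff, Finset.mem_filter, Finset.mem_univ, true_and] at hi
      exact hi.1.le
    have h3 : (F \ G).card ≤ (G \ F).card :=
      Finset.card_sdiff_le_card_sdiff_iff.2 (hF.trans hGc.ge)
    have h4 := Finset.sum_inter_add_sum_sdiff F G f
    have h5 := Finset.sum_inter_add_sum_sdiff G F f
    have h6 : (F \ G).card • f ⟨k, hk⟩ ≤ (G \ F).card • f ⟨k, hk⟩ := Nat.mul_le_mul_right _ h3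
    rw [Finset.inter_comm] at h5
    omega
  · have : G = Finset.univ := by
      rw [hG, Finset.filter_eq_self]
      exact fun i _ => by omega
    rw [this]
    exact Finset.sum_le_sum_of_subset (Finset.subset_univ _)

theorem exp_neg_le_one_sub_pow (x : ℝ) (n : ℕ) (hx : 0 ≤ x) (hx2 : x ≤ 1 / 2) :
    Real.exp (-(2 * x * n)) ≤ (1 - x) ^ n := by
  have h : Real.exp (-(2 * x)) ≤ 1 - x := by
    rw [← Real.le_log_iff_exp_le (by linarith)]
    have h1 := Real.one_sub_inv_le_log_of_pos (show 0 < 1 - x by linarith)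
    have h2 : (1 - x)⁻¹ ≤ 1 + 2 * x := by
      rw [inv_le_iff_one_le_mul₀ (by linarith)]
      nlinarith
    linarith
  calc Real.exp (-(2 * x * n)) = Real.exp (-(2 * x)) ^ n := by
        rw [← Real.exp_nat_mul]; ring_nf
    _ ≤ _ := by gcongr

end Vectors

/-! ### Bounds for given margins -/

namespace Margins

variable (M : Margins)

theorem row_one : M.row 1 = leading M.r := by
  simp only [row, leading, le_refl, true_and]
  rfl

theorem col_one : M.col 1 = leading M.c := by
  simp only [col, leading, le_refl, true_and]
  rfl

theorem card_rowToken : Fintype.card M.RowToken = M.total := by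
  simp [total]

theorem card_colToken : Fintype.card M.ColToken = M.total := by
  simp [total, M.sum_eq]

theorem card_rowToken_eq : Fintype.card M.RowToken = Fintype.card M.ColToken := by
  rw [card_rowToken, card_colToken]

theorem doubleSum_eq : M.doubleSum = (pairCount M.r : ℝ) * pairCount M.c := by
  have cast : ∀ {n : ℕ} (f : Fin n → ℕ),
      ((pairCount f : ℕ) : ℝ) = ∑ i, (f i : ℝ) * ((f i : ℝ) - 1) := by
    intro n f
    rw [pairCount]
    push_cast
    refine Finset.sum_congr rfl fun i _ => ?_
    rcases Nat.eq_zero_or_pos (f i) with h | h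
    · simp [h]
    · rw [Nat.cast_sub h]; simp
  rw [doubleSum, cast, cast, Finset.sum_mul_sum]

/-- The marginals of a table hold automatically, so it is binary exactly for simple matchings. -/
theorem table_mem_binaryTables_iff (σ : M.Matching) : M.table σ ∈ M.binaryTables ↔
    IsSimpleMatching (Sigma.fst : M.RowToken → Fin M.m) (Sigma.fst : M.ColToken → Fin M.n) σ := by
  have hrow : ∀ i, ∑ j, M.table σ i j = M.r i := by
    intro i
    simp only [table, Fintype.card_subtype]
    rw [← Finset.card_eq_sum_card_fiberwise (f := fun t : Fin (M.r i) => (σ ⟨i, t⟩).1)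
      (s := Finset.univ) (t := Finset.univ) (by intro _ _; simp)]
    simp
  have htab : ∀ i j, M.table σ i j =
      (Finset.univ.filter fun s : M.RowToken => s.1 = i ∧ (σ s).1 = j).card := by
    intro i j
    rw [table, Fintype.card_subtype]
    refine Finset.card_bij (fun t _ => ⟨i, t⟩) ?_ ?_ ?_
    · intro t ht; simpa using ht
    · intro t _ t' _ h; simpa using h
    · rintro ⟨i', t⟩ h
      simp only [Finset.mem_filter, Finset.mem_univ, true_and] at h
      obtain ⟨rfl, h⟩ := h
      exact ⟨t, by simpa using h, rfl⟩
  have hcol : ∀ j, ∑ i, M.table σ i j = M.c j := by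
    intro j
    simp only [htab]
    have h1 := Finset.card_eq_sum_card_fiberwise (f := fun s : M.RowToken => s.1)
      (s := Finset.univ.filter fun s : M.RowToken => (σ s).1 = j) (t := Finset.univ)
      (by intro _ _; simp)
    have h2 : (Finset.univ.filter fun s : M.RowToken => (σ s).1 = j).card = M.c j := by
      rw [← card_filter_fst_eq M.c j]
      refine Finset.card_bij (fun s _ => σ s) ?_ ?_ ?_
      · intro s hs; simpa using hs
      · intro s _ t _ h; exact σ.injective h
      · intro u hu
        exact ⟨σ.symm u, by simpa using hu, by simp⟩
    rw [← h2, h1]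
    refine Finset.sum_congr rfl fun i _ => ?_
    rw [Finset.filter_filter]
    congr 1
    ext s
    simp [and_comm]
  have hbin : M.table σ ∈ M.binaryTables ↔ ∀ i j, M.table σ i j ≤ 1 := by
    constructor
    · intro h i j
      rcases h.1 i j with h | h <;> omega
    · intro h
      exact ⟨fun i j => by have := h i j; omega, hrow, hcol⟩
  rw [hbin]
  simp only [htab, Finset.card_le_one, Finset.mem_filter, Finset.mem_univ, true_and]
  constructor
  · intro h s t h1 h2
    exact h s.1 (σ s).1 s ⟨rfl, rfl⟩ t ⟨h1.symm, h2.symm⟩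
  · rintro h i j s ⟨h1, h2⟩ t ⟨h3, h4⟩
    exact h s t (h1.trans h3.symm) (h2.trans h4.symm)

/-- The number of simple matchings between the row tokens and the column tokens. -/
def simpleCount : ℕ := (Finset.univ.filter (IsSimpleMatching
  (Sigma.fst : M.RowToken → Fin M.m) (Sigma.fst : M.ColToken → Fin M.n))).card

theorem card_matching_pos : (0 : ℝ) < Fintype.card M.Matching := by
  exact_mod_cast Fintype.card_pos

theorem probBinary_eq : M.probBinary = (M.simpleCount : ℝ) / Fintype.card M.Matching := by
  classical
  have : M.table ⁻¹' M.binaryTables =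
      {σ | IsSimpleMatching (Sigma.fst : M.RowToken → Fin M.m)
        (Sigma.fst : M.ColToken → Fin M.n) σ} := by
    ext σ
    exact M.table_mem_binaryTables_iff σ
  rw [probBinary, configurationModel, PMF.toOuterMeasure_map_apply, this,
    PMF.toOuterMeasure_uniformOfFintype_apply, ENNReal.toReal_div, simpleCount,
    ENNReal.toReal_natCast, ENNReal.toReal_natCast]
  congr 2
  rw [← Fintype.card_subtype]
  exact Fintype.card_congr (Equiv.refl _)

theorem probBinary_nonneg : 0 ≤ M.probBinary := by
  rw [probBinary_eq]; positivity

theorem tail_eq (k : ℕ) : M.tail k =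
    (((Finset.univ.filter fun a : M.RowToken => k ≤ a.1.val + 1).card : ℕ) : ℝ) / M.total := by
  rw [tail, card_filter_fst M.r fun i => k ≤ i.val + 1, Nat.cast_sum, Finset.sum_div]
  refine Finset.sum_congr rfl fun i _ => ?_
  simp only [Nat.cast_le]
  split_ifs <;> simp

theorem tail_nonneg (k : ℕ) : 0 ≤ M.tail k := by
  rw [tail_eq]; positivity

theorem tail_le_one (k : ℕ) : M.tail k ≤ 1 := by
  rw [tail_eq]
  refine div_le_one_of_le₀ ?_ (by positivity)
  rw [← card_rowToken]
  exact_mod_cast Finset.card_le_univ _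

/-- Fewer than `k` rows leave at least the mass of the rows `k, k + 1, …`. -/
theorem card_tail_le (k : ℕ) (F : Finset (Fin M.m)) (hF : F.card < k) :
    (Finset.univ.filter fun a : M.RowToken => k ≤ a.1.val + 1).card ≤
      (Finset.univ.filter fun a : M.RowToken => a.1 ∉ F).card := by
  have h := sum_le_sum_of_card_le M.r_anti (k - 1) F (by omega)
  have h1 := Finset.card_filter_add_card_filter_not (s := (Finset.univ : Finset M.RowToken))
    (fun a => a.1 ∈ F)
  have h2 := Finset.card_filter_add_card_filter_not (s := (Finset.univ : Finset M.RowToken))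
    (fun a => a.1.val < k - 1)
  have h3 : (Finset.univ.filter fun a : M.RowToken => k ≤ a.1.val + 1) =
      Finset.univ.filter fun a : M.RowToken => ¬ a.1.val < k - 1 := by
    ext a
    simp only [Finset.mem_filter, Finset.mem_univ, true_and]
    omega
  have e1 : (Finset.univ.filter fun a : M.RowToken => a.1 ∈ F).card = ∑ i ∈ F, M.r i := by
    rw [card_filter_fst M.r fun i => i ∈ F]
    simp
  have e2 : (Finset.univ.filter fun a : M.RowToken => a.1.val < k - 1).card =
      ∑ i ∈ Finset.univ.filter fun i : Fin M.m => i.val < k - 1, M.r i := by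
    rw [card_filter_fst M.r fun i => i.val < k - 1, Finset.sum_filter]
  rw [h3]
  omega

theorem row_fiber_le (s : M.RowToken) :
    (Finset.univ.filter fun t : M.RowToken => t.1 = s.1).card ≤ M.row 1 := by
  rw [card_filter_fst_eq, row_one]
  exact le_leading M.r_anti _

theorem col_fiber_le (s : M.ColToken) :
    (Finset.univ.filter fun t : M.ColToken => t.1 = s.1).card ≤ M.col 1 := by
  rw [card_filter_fst_eq, col_one]
  exact le_leading M.c_anti _

/-- If the largest column has at least `k` tokens, one of them has to be matched into the rows
`k, k + 1, …`. -/
theorem probBinary_le_tail (k : ℕ) (hk : 1 ≤ k) (hkc : k ≤ M.col 1) :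
    M.probBinary ≤ k * M.tail k := by
  rw [col_one, leading] at hkc
  split_ifs at hkc with hn
  swap
  · omega
  let U : Finset M.ColToken := Finset.univ.image fun x : Fin k => ⟨⟨0, hn⟩, Fin.castLE hkc x⟩
  have hU : U.card = k := by
    rw [Finset.card_image_of_injective, Finset.card_univ, Fintype.card_fin]
    intro x y h
    simpa using h
  let F : Finset (Fin M.m) := Finset.univ.filter fun i => i.val < k - 1
  have hF : F.card < U.card := by
    rw [hU, Fin.card_filter_val_lt]
    omega
  have := card_isSimpleMatching_le_of_pigeonhole M.card_rowToken_eq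
    (Sigma.fst : M.RowToken → Fin M.m) (Sigma.fst : M.ColToken → Fin M.n) U (by
      intro u hu v hv
      obtain ⟨x, _, rfl⟩ := Finset.mem_image.1 hu
      obtain ⟨y, _, rfl⟩ := Finset.mem_image.1 hv
      rfl) F hF
  have hset : (Finset.univ.filter fun a : M.RowToken => a.1 ∉ F) =
      Finset.univ.filter fun a : M.RowToken => k ≤ a.1.val + 1 := by
    ext a
    simp only [F, Finset.mem_filter, Finset.mem_univ, true_and]
    omega
  have hpos : 0 < M.total := by
    rw [← card_colToken]
    exact Fintype.card_pos_iff.2 ⟨⟨⟨0, hn⟩, ⟨0, by omega⟩⟩⟩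
  have hpos' : (0 : ℝ) < M.total := by exact_mod_cast hpos
  rw [hset, hU, card_rowToken] at this
  rw [probBinary_eq, div_le_iff₀ M.card_matching_pos, tail_eq, mul_div_assoc', div_mul_eq_mul_div,
    le_div_iff₀ hpos']
  exact_mod_cast this

/-- Sequential exposure: there are at most `K` tokens in columns of size at least two, and each of them
finds a fraction at least `ε / 2` of the row tokens free, whatever rows its column already uses. -/
theorem le_probBinary_of_few (K : ℕ) (ε : ℝ) (hε : 0 < ε) (hK : pairCount M.c ≤ K)
    (hN : 2 * K ≤ ε * M.total) (hpos : 0 < M.total) (htail : ε ≤ M.tail (M.col 1 : ℕ)) :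
    (ε / 2) ^ K ≤ M.probBinary := by
  have hpos' : (0 : ℝ) < M.total := by exact_mod_cast hpos
  have hε1 : ε ≤ 1 := htail.trans (M.tail_le_one _)
  set L := (Finset.univ.filter fun a : M.RowToken => M.col 1 ≤ a.1.val + 1).card with hL
  let U : Finset M.ColToken := (fiberPairs (Sigma.fst : M.ColToken → Fin M.n)).image Prod.fst
  have hUK : U.card ≤ K :=
    Finset.card_image_le.trans ((card_fiberPairs_token M.c).trans_le hK)
  have key := le_card_isSimpleMatching_of_few (Sigma.fst : M.RowToken → Fin M.m)
    (Sigma.fst : M.ColToken → Fin M.n) (M.col 1) L M.col_fiber_le (fun F hF => M.card_tail_le _ F hF)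
    U (fun u v huv h => Finset.mem_image.2 ⟨(u, v), by simp [fiberPairs, huv, h], rfl⟩)
  have hLN : ε * M.total ≤ L := by
    rw [tail_eq, le_div_iff₀ hpos'] at htail
    exact htail
  have hUK' : (U.card : ℝ) ≤ K := by exact_mod_cast hUK
  have hLU : U.card ≤ L := by
    have : (U.card : ℝ) ≤ L := by linarith [(Nat.cast_nonneg K : (0 : ℝ) ≤ K)]
    exact_mod_cast this
  have hdiff : ε / 2 * M.total ≤ ((L - U.card : ℕ) : ℝ) := by
    rw [Nat.cast_sub hLU]
    linarith
  rw [probBinary_eq, le_div_iff₀ M.card_matching_pos]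
  have key' : (((L - U.card : ℕ) : ℝ)) ^ U.card * Fintype.card M.Matching ≤
      (M.total : ℝ) ^ U.card * M.simpleCount := by
    rw [card_rowToken] at key
    exact_mod_cast key
  have h1 : (ε / 2) ^ K ≤ (ε / 2) ^ U.card :=
    pow_le_pow_of_le_one (by positivity) (by linarith) hUK
  refine le_of_mul_le_mul_left (a := (M.total : ℝ) ^ U.card) ?_ (by positivity)
  calc (M.total : ℝ) ^ U.card * ((ε / 2) ^ K * Fintype.card M.Matching)
      ≤ (M.total : ℝ) ^ U.card * ((ε / 2) ^ U.card * Fintype.card M.Matching) := by gcongr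
    _ = (ε / 2 * M.total) ^ U.card * Fintype.card M.Matching := by rw [mul_pow]; ring
    _ ≤ (((L - U.card : ℕ) : ℝ)) ^ U.card * Fintype.card M.Matching := by gcongr
    _ ≤ _ := key'

/-- The second moment method: a probability bounded below forces `doubleSum = O(N²)`. -/
theorem doubleSum_le_of_le_probBinary (η : ℝ) (hη : 0 < η) (hN : 6 ≤ M.total)
    (hNη : 48 / η ≤ M.total) (hP : η ≤ M.probBinary) :
    M.doubleSum ≤ (16 / η + (64 / η) ^ 2) * (M.total : ℝ) ^ 2 := by
  by_contra! hcon
  set w : ℝ := (pairCount M.r : ℝ) * pairCount M.c with hw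
  rw [doubleSum_eq, ← hw] at hcon
  have hN' : (6 : ℝ) ≤ M.total := by exact_mod_cast hN
  set C := 16 / η + (64 / η) ^ 2 with hC
  have hC0 : 0 < C := by positivity
  have hwpos : 0 < w := lt_of_le_of_lt (by positivity) hcon
  have hr : 0 < pairCount M.r := by
    rcases Nat.eq_zero_or_pos (pairCount M.r) with h | h
    · rw [hw, h] at hwpos; simp at hwpos
    · exact h
  have hc : 0 < pairCount M.c := by
    rcases Nat.eq_zero_or_pos (pairCount M.c) with h | h
    · rw [hw, h] at hwpos; simp at hwpos
    · exact h
  set μ : ℝ := w / ((M.total : ℝ) * ((M.total : ℝ) - 1)) with hμ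
  have hMpos : 0 < (M.total : ℝ) * ((M.total : ℝ) - 1) := by nlinarith
  have hμC : C ≤ μ := by
    rw [hμ, le_div_iff₀ hMpos]
    nlinarith
  have key := card_isSimpleMatching_le M.card_rowToken_eq (Sigma.fst : M.RowToken → Fin M.m)
    (Sigma.fst : M.ColToken → Fin M.n) (M.row 1) (M.col 1) M.row_fiber_le M.col_fiber_le
    (by rw [card_fiberPairs_token, row_one]; exact sq_leading_le M.r_anti hr)
    (by rw [card_fiberPairs_token, col_one]; exact sq_leading_le M.c_anti hc)
    M.total w μ (by rw [card_rowToken]) hN'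
    (by rw [card_fiberPairs_token, card_fiberPairs_token]) hwpos hμ
  have hP' : M.probBinary ≤ 12 / M.total + 4 / μ + 16 / √μ := by
    rw [probBinary_eq, div_le_iff₀ M.card_matching_pos]
    exact key
  have b1 : 12 / (M.total : ℝ) ≤ η / 4 := by
    rw [div_le_iff₀ (by linarith)]
    rw [div_le_iff₀ hη] at hNη
    linarith
  have b2 : 4 / μ ≤ η / 4 := by
    have : 16 / η ≤ μ := le_trans (by rw [hC]; nlinarith [sq_nonneg (64 / η)]) hμC
    rw [div_le_iff₀ hη] at this
    rw [div_le_iff₀ (by linarith)]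
    linarith
  have b3 : 16 / √μ ≤ η / 4 := by
    have h1 : 64 / η ≤ √μ := by
      apply Real.le_sqrt_of_sq_le
      exact le_trans (by rw [hC]; linarith [show 0 < 16 / η by positivity]) hμC
    have h2 : 0 < √μ := Real.sqrt_pos.2 (by linarith)
    rw [div_le_iff₀ hη] at h1
    rw [div_le_iff₀ h2]
    linarith
  linarith

/-- The local lemma applied to light margins with `doubleSum = O(N²)`. The condition of the local lemma is
checked by comparing `r₁` and `c₁` with a large constant `Λ`: a large `r₁` makes
`(r₁ - 1) ∑ c_j (c_j - 1)` small against `doubleSum`. -/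
theorem le_probBinary_of_light (C Λ : ℝ) (hΛ1 : 1 ≤ Λ) (hΛ : 64 * C ≤ Λ)
    (hN3 : 3 ≤ M.total) (hN : 64 * Λ ^ 2 ≤ M.total) (hd : M.doubleSum ≤ C * (M.total : ℝ) ^ 2)
    (hcr : M.col 1 ≤ M.row 1) (hr : 64 * Λ * M.row 1 ≤ M.total) :
    Real.exp (-(8 * C)) ≤ M.probBinary := by
  have hN3' : (3 : ℝ) ≤ M.total := by exact_mod_cast hN3
  rw [doubleSum_eq] at hd
  set R : ℝ := (pairCount M.r : ℝ) with hR
  set S : ℝ := (pairCount M.c : ℝ) with hS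
  set N : ℝ := (M.total : ℝ) with hNdef
  set a : ℝ := (M.row 1 : ℝ) with ha
  set b : ℝ := (M.col 1 : ℝ) with hb
  set a' : ℝ := ((M.row 1 - 1 : ℕ) : ℝ) with ha'
  set b' : ℝ := ((M.col 1 - 1 : ℕ) : ℝ) with hb'
  have hR0 : 0 ≤ R := Nat.cast_nonneg _
  have hS0 : 0 ≤ S := Nat.cast_nonneg _
  have ha0 : 0 ≤ a' := Nat.cast_nonneg _
  have hb0 : 0 ≤ b' := Nat.cast_nonneg _
  have haa : a' ≤ a := by rw [ha, ha']; exact_mod_cast Nat.sub_le _ _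
  have hbb : b' ≤ b := by rw [hb, hb']; exact_mod_cast Nat.sub_le _ _
  have hba : b ≤ a := by rw [hb, ha]; exact_mod_cast hcr
  have h1 : a * a' ≤ R := by
    have := leading_mul_le_pairCount M.r
    rw [← row_one] at this
    rw [ha, ha', hR]; exact_mod_cast this
  have h2 : b * b' ≤ S := by
    have := leading_mul_le_pairCount M.c
    rw [← col_one] at this
    rw [hb, hb', hS]; exact_mod_cast this
  have h3 : R ≤ a' * N := by
    have := pairCount_le M.r_anti
    rw [← row_one, ← total] at this
    rw [hR, ha', hNdef]; exact_mod_cast this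
  have h4 : S ≤ b' * N := by
    have := pairCount_le M.c_anti
    rw [← col_one, ← M.sum_eq, ← total] at this
    rw [hS, hb', hNdef]; exact_mod_cast this
  have hN0 : 0 < N := by linarith
  have s1 : 64 * (a' * S) ≤ N ^ 2 := by
    by_cases h : Λ ≤ a
    · have : Λ * (64 * (a' * S)) ≤ Λ * N ^ 2 := by
        calc Λ * (64 * (a' * S)) ≤ a * (64 * (a' * S)) := by gcongr
          _ = 64 * (a * a' * S) := by ring
          _ ≤ 64 * (R * S) := by gcongr
          _ ≤ 64 * (C * N ^ 2) := by gcongr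
          _ = 64 * C * N ^ 2 := by ring
          _ ≤ Λ * N ^ 2 := by gcongr
      exact le_of_mul_le_mul_left this (by linarith)
    · push Not at h
      calc 64 * (a' * S) ≤ 64 * (Λ * (Λ * N)) := by
            gcongr
            · linarith
            · refine h4.trans ?_
              gcongr
              linarith
        _ = 64 * Λ ^ 2 * N := by ring
        _ ≤ N * N := by gcongr
        _ = N ^ 2 := by ring
  have s2 : 64 * (b' * R) ≤ N ^ 2 := by
    by_cases h : Λ ≤ b
    · have : Λ * (64 * (b' * R)) ≤ Λ * N ^ 2 := by
        calc Λ * (64 * (b' * R)) ≤ b * (64 * (b' * R)) := by gcongr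
          _ = 64 * (R * (b * b')) := by ring
          _ ≤ 64 * (R * S) := by gcongr
          _ ≤ 64 * (C * N ^ 2) := by gcongr
          _ = 64 * C * N ^ 2 := by ring
          _ ≤ Λ * N ^ 2 := by gcongr
      exact le_of_mul_le_mul_left this (by linarith)
    · push Not at h
      calc 64 * (b' * R) ≤ 64 * (Λ * (a * N)) := by
            gcongr
            · linarith
            · refine h3.trans ?_
              gcongr
        _ = 64 * Λ * a * N := by ring
        _ ≤ N * N := by gcongr
        _ = N ^ 2 := by ring
  have hNN : N ^ 2 ≤ 2 * (N * (N - 1)) := by nlinarith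
  have cond : 16 * ((M.row 1 - 1) * pairCount M.c + (M.col 1 - 1) * pairCount M.r) ≤
      M.total * (M.total - 1) := by
    have : 16 * (a' * S + b' * R) ≤ N * (N - 1) := by linarith
    have e : ((M.total - 1 : ℕ) : ℝ) = N - 1 := by rw [Nat.cast_sub (by omega)]; simp [hNdef]
    rw [← e] at this
    rw [ha', hS, hb', hR, hNdef] at this
    exact_mod_cast this
  have key := le_card_isSimpleMatching (Sigma.fst : M.RowToken → Fin M.m)
    (Sigma.fst : M.ColToken → Fin M.n) (M.row 1) (M.col 1) M.row_fiber_le M.col_fiber_le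
    (by rw [card_colToken]; omega)
    (by rw [card_colToken, card_fiberPairs_token, card_fiberPairs_token]; exact cond)
  rw [card_fiberPairs_token, card_fiberPairs_token, card_colToken, ← hNdef] at key
  rw [probBinary_eq, le_div_iff₀ M.card_matching_pos]
  refine le_trans ?_ key
  refine mul_le_mul_of_nonneg_right ?_ M.card_matching_pos.le
  have hM : 4 ≤ N * (N - 1) := by nlinarith
  refine le_trans ?_ (exp_neg_le_one_sub_pow (2 / (N * (N - 1))) _ (by positivity) ?_)
  · rw [Real.exp_le_exp, neg_le_neg_iff]
    have : 2 * (2 / (N * (N - 1))) * ((pairCount M.r * pairCount M.c : ℕ) : ℝ) =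
        4 * (R * S) / (N * (N - 1)) := by push_cast; ring
    rw [this, div_le_iff₀ (by linarith)]
    have hC0 : 0 ≤ C := by
      have : 0 ≤ C * N ^ 2 := le_trans (by positivity) hd
      exact nonneg_of_mul_nonneg_left this (by positivity)
    nlinarith
  · rw [div_le_div_iff₀ (by linarith) (by norm_num)]
    linarith

end Margins

/-! ### Sequences of margins -/

section Asymptotic

namespace Margins

theorem doubleSum_nonneg (M : Margins) : 0 ≤ M.doubleSum := by
  rw [doubleSum_eq]; positivity

theorem row_le_tail_mul (M : Margins) (k : ℕ) : (M.row k : ℝ) ≤ M.tail k * M.total := by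
  have h : M.row k ≤ (Finset.univ.filter fun a : M.RowToken => k ≤ a.1.val + 1).card := by
    rw [row]
    split_ifs with h
    · rw [← card_filter_fst_eq M.r]
      refine Finset.card_le_card fun a ha => ?_
      simp only [Finset.mem_filter, Finset.mem_univ, true_and] at ha ⊢
      rw [ha]
      simp only
      omega
    · exact Nat.zero_le _
  rcases Nat.eq_zero_or_pos M.total with h0 | h0
  · have h1 : (Finset.univ.filter fun a : M.RowToken => k ≤ a.1.val + 1).card ≤ M.total := by
      rw [← card_rowToken]; exact Finset.card_le_univ _
    have : M.row k = 0 := by omega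
    simp [this, h0]
  · rw [tail_eq, div_mul_cancel₀ _ (by exact_mod_cast h0.ne')]
    exact_mod_cast h

theorem tail_le_add_tail (M : Margins) (i c : ℕ) (hi : 1 ≤ i) :
    M.tail i ≤ c * ((M.row i : ℝ) / M.total) + M.tail c := by
  have h : M.tail i ≤ ∑ j : Fin M.m, ((if j.val < c then (M.row i : ℝ) / M.total else 0) +
      if (c : ℕ∞) ≤ ((j.val + 1 : ℕ) : ℕ∞) then (M.r j : ℝ) / M.total else 0) := by
    refine Finset.sum_le_sum fun j _ => ?_
    simp only [Nat.cast_le]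
    have p1 : 0 ≤ (M.row i : ℝ) / M.total := by positivity
    have p2 : 0 ≤ (M.r j : ℝ) / M.total := by positivity
    by_cases h1 : i ≤ j.val + 1
    · rw [if_pos h1]
      by_cases h2 : c ≤ j.val + 1
      · rw [if_pos h2]
        split_ifs <;> linarith
      · rw [if_neg h2, if_pos (by omega), add_zero]
        have h3 : M.r j ≤ M.row i := by
          have := j.isLt
          rw [row, dif_pos (by omega)]
          refine M.r_anti ?_
          rw [Fin.le_def]
          simp only
          omega
        gcongr
    · rw [if_neg h1]
      split_ifs <;> linarith
  refine h.trans ?_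
  rw [Finset.sum_add_distrib, tail]
  gcongr
  rw [← Finset.sum_filter, Finset.sum_const, Fin.card_filter_val_lt, nsmul_eq_mul]
  gcongr
  exact min_le_right _ _

end Margins

theorem kappa_le (S : ℕ → Margins) {i : ℕ} (hi : 1 ≤ i)
    (h : (fun l => ((S l).row i : ℝ)) =o[atTop] (fun l => ((S l).total : ℝ))) : kappa S ≤ i :=
  sInf_le ⟨i, hi, rfl, h⟩

theorem exists_eq_kappa (S : ℕ → Margins) (h : kappa S ≠ ⊤) : ∃ i : ℕ, 1 ≤ i ∧ kappa S = i ∧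
    (fun l => ((S l).row i : ℝ)) =o[atTop] (fun l => ((S l).total : ℝ)) := by
  rw [kappa] at h ⊢
  exact csInf_mem (s := {k : ℕ∞ | ∃ i : ℕ, 1 ≤ i ∧ k = (i : ℕ∞) ∧
    (fun l => ((S l).row i : ℝ)) =o[atTop] (fun l => ((S l).total : ℝ))})
    (Set.nonempty_iff_ne_empty.2 fun he => h (by rw [he, sInf_empty]))

theorem isBigO_one_probBinary_iff (S : ℕ → Margins) :
    ((fun _ : ℕ => (1 : ℝ)) =O[atTop] fun N => (S N).probBinary) ↔
      ∃ η : ℝ, 0 < η ∧ ∀ᶠ N in atTop, η ≤ (S N).probBinary := by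
  rw [isBigO_iff']
  simp only [norm_one, Real.norm_of_nonneg (Margins.probBinary_nonneg _)]
  constructor
  · rintro ⟨c, hc, h⟩
    refine ⟨c⁻¹, inv_pos.2 hc, h.mono fun N hN => ?_⟩
    rwa [inv_le_iff_one_le_mul₀' hc]
  · rintro ⟨η, hη, h⟩
    refine ⟨η⁻¹, inv_pos.2 hη, h.mono fun N hN => ?_⟩
    rw [inv_mul_eq_div, one_le_div hη]
    exact hN

/-- Condition (2) is necessary: otherwise, along the subsequence, infinitely often a column has to
put one of its tokens into rows of negligible total mass. -/
theorem limsup_of_le_probBinary (T : ℕ → Margins) (η : ℝ) (hη : 0 < η)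
    (hP : ∀ᶠ l in atTop, η ≤ (T l).probBinary) (hk : kappa T ≠ ⊤) :
    0 < limsup (fun l => (T l).tail (kappa T)) atTop ∨
      limsup (fun l => ((T l).col 1 : ℕ∞)) atTop < kappa T := by
  obtain ⟨i, hi, hκ, -⟩ := exists_eq_kappa T hk
  rw [hκ]
  by_contra! hcon
  obtain ⟨h1, h2⟩ := hcon
  have hi' : (0 : ℝ) < i := by exact_mod_cast hi
  have small : ∀ᶠ l in atTop, (T l).tail i < η / i :=
    eventually_lt_of_limsup_lt (h1.trans_lt (by positivity))
      (isBoundedUnder_of ⟨1, fun l => (T l).tail_le_one i⟩)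
  have freq : ∃ᶠ l in atTop, i ≤ (T l).col 1 := by
    intro hlt
    have : limsup (fun l => ((T l).col 1 : ℕ∞)) atTop ≤ ((i - 1 : ℕ) : ℕ∞) := by
      refine limsup_le_of_le (h := ?_)
      filter_upwards [hlt] with l hl
      rw [Nat.cast_le]
      omega
    have := h2.trans this
    rw [Nat.cast_le] at this
    omega
  obtain ⟨l, hl, hs, hp⟩ := (freq.and_eventually (small.and hP)).exists
  have h3 := (T l).probBinary_le_tail i hi hl
  rw [lt_div_iff₀ hi'] at hs
  linarith

/-- Consequence of condition (2): where the largest column has `c` tokens, the rows `c, c + 1, …`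
carry a positive fraction of the mass. On a subsequence violating this, `r_c = o(N)`, so `κ ≤ c`, and
the mass of the rows `κ, κ + 1, …` tends to `0` as well. -/
theorem eventually_le_tail (S : ℕ → Margins) (hN : ∀ N : ℕ, 1 ≤ N → (S N).total = N)
    (h2 : ∀ k : ℕ → ℕ, StrictMono k → kappa (fun l => S (k l)) ≠ ⊤ →
      0 < limsup (fun l : ℕ => (S (k l)).tail (kappa (fun l => S (k l)))) atTop ∨
      limsup (fun l : ℕ => ((S (k l)).col 1 : ℕ∞)) atTop < kappa (fun l => S (k l))) (c : ℕ) :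
    ∃ ε : ℝ, 0 < ε ∧ ∀ᶠ N in atTop, (S N).col 1 = c → ε ≤ (S N).tail c := by
  rcases Nat.eq_zero_or_pos c with rfl | hc
  · refine ⟨1, one_pos, ?_⟩
    filter_upwards [eventually_ge_atTop 1] with N h1 _
    rw [Margins.tail_eq]
    simp only [Nat.zero_le, Finset.filter_true, Finset.card_univ, Margins.card_rowToken, hN N h1]
    rw [div_self (by positivity)]
  by_contra! hcon
  obtain ⟨φ, hφ, hφp⟩ := extraction_forall_of_frequently
    (P := fun n N => (S N).col 1 = c ∧ (S N).tail c < 1 / ((n : ℝ) + 1)) (fun n => by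
      have := hcon (1 / ((n : ℝ) + 1)) (by positivity)
      simpa only [not_eventually, Classical.not_imp, not_le] using this)
  have htail : Tendsto (fun l => (S (φ l)).tail c) atTop (𝓝 0) :=
    squeeze_zero (fun l => (S (φ l)).tail_nonneg c) (fun l => (hφp l).2.le)
      tendsto_one_div_add_atTop_nhds_zero_nat
  have hrow : (fun l => ((S (φ l)).row c : ℝ)) =o[atTop] fun l => ((S (φ l)).total : ℝ) := by
    rw [isLittleO_iff]
    intro ε hε
    filter_upwards [htail.eventually (gt_mem_nhds hε)] with l hl
    rw [Real.norm_natCast, Real.norm_natCast]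
    exact ((S (φ l)).row_le_tail_mul c).trans (by gcongr)
  have hκc := kappa_le (fun l => S (φ l)) hc hrow
  have hκ : kappa (fun l => S (φ l)) ≠ ⊤ := ne_top_of_le_ne_top (ENat.natCast_ne_top c) hκc
  have h2 := h2 φ hφ hκ
  obtain ⟨i, hi, hκi, hrowi⟩ := exists_eq_kappa _ hκ
  rw [hκi] at h2 hκc
  rcases h2 with h | h
  · have hi0 : Tendsto (fun l => (S (φ l)).tail i) atTop (𝓝 0) := by
      refine squeeze_zero (fun l => (S (φ l)).tail_nonneg i)
        (fun l => (S (φ l)).tail_le_add_tail i c hi) ?_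
      simpa using (hrowi.tendsto_div_nhds_zero.const_mul (c : ℝ)).add htail
    rw [hi0.limsup_eq] at h
    exact lt_irrefl _ h
  · have : (fun l => ((S (φ l)).col 1 : ℕ∞)) = fun _ => (c : ℕ∞) :=
      funext fun l => by rw [(hφp l).1]
    rw [this, limsup_const] at h
    exact absurd hκc (not_le.2 h)

/-- If the largest row is of linear size, `doubleSum = O(N²)` leaves boundedly many pairs of tokens
in a common column. -/
theorem Margins.pairCount_col_le (M : Margins) (C Λ : ℝ) (hΛ : 0 < Λ)
    (hd : M.doubleSum ≤ C * (M.total : ℝ) ^ 2) (hr : (M.total : ℝ) < Λ * M.row 1)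
    (hN : 2 * Λ ≤ M.total) : (pairCount M.c : ℝ) ≤ 2 * C * Λ ^ 2 := by
  rw [doubleSum_eq] at hd
  have h1 : (2 : ℝ) < M.row 1 := by
    refine lt_of_mul_lt_mul_left (a := Λ) ?_ hΛ.le
    linarith
  have h1' : 2 < M.row 1 := by exact_mod_cast h1
  have h2 : (M.row 1 : ℝ) ^ 2 ≤ 2 * pairCount M.r := by
    have h := leading_mul_le_pairCount M.r
    rw [← row_one] at h
    have h' : (M.row 1 : ℝ) * ((M.row 1 : ℝ) - 1) ≤ pairCount M.r := by
      have e : ((M.row 1 - 1 : ℕ) : ℝ) = (M.row 1 : ℝ) - 1 := by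
        rw [Nat.cast_sub (by omega)]; simp
      rw [← e]
      exact_mod_cast h
    nlinarith
  have hN0 : (0 : ℝ) < M.total := by linarith
  have h3 : (M.total : ℝ) ^ 2 ≤ Λ ^ 2 * (2 * pairCount M.r) := by
    calc (M.total : ℝ) ^ 2 ≤ (Λ * M.row 1) ^ 2 := by gcongr
      _ = Λ ^ 2 * (M.row 1 : ℝ) ^ 2 := by ring
      _ ≤ _ := by gcongr
  refine le_of_mul_le_mul_left (a := (M.total : ℝ) ^ 2) ?_ (by positivity)
  calc (M.total : ℝ) ^ 2 * pairCount M.c ≤ Λ ^ 2 * (2 * pairCount M.r) * pairCount M.c := by gcongr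
    _ = 2 * Λ ^ 2 * (pairCount M.r * pairCount M.c) := by ring
    _ ≤ 2 * Λ ^ 2 * (C * (M.total : ℝ) ^ 2) := by gcongr
    _ = _ := by ring

/-- Conditions (1) and (2) are sufficient; margins are light or heavy according to the size of `r₁`
against `N`. -/
theorem exists_le_probBinary (S : ℕ → Margins) (hN : ∀ N : ℕ, 1 ≤ N → (S N).total = N)
    (hrc : ∀ N : ℕ, 1 ≤ N → (S N).col 1 ≤ (S N).row 1) (C : ℝ) (hC : 0 < C)
    (h1 : ∀ᶠ N : ℕ in atTop, (S N).doubleSum ≤ C * (N : ℝ) ^ 2)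
    (h2 : ∀ c : ℕ, ∃ ε : ℝ, 0 < ε ∧ ∀ᶠ N in atTop, (S N).col 1 = c → ε ≤ (S N).tail c) :
    ∃ η : ℝ, 0 < η ∧ ∀ᶠ N in atTop, η ≤ (S N).probBinary := by
  choose ε hε hev using h2
  set Λ : ℝ := 1 + 64 * C with hΛ
  obtain ⟨K, hK⟩ := exists_nat_ge (2 * C * (64 * Λ) ^ 2)
  obtain ⟨c₀, -, hc₀⟩ := Finset.exists_min_image (Finset.range (K + 2)) ε ⟨0, by simp⟩
  have hall : ∀ᶠ N in atTop, ∀ c ∈ Finset.range (K + 2), (S N).col 1 = c → ε c ≤ (S N).tail c :=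
    (eventually_all_finset _).2 fun c _ => hev c
  have big : ∀ x : ℝ, ∀ᶠ N : ℕ in atTop, x ≤ N := fun x =>
    tendsto_natCast_atTop_atTop.eventually_ge_atTop x
  refine ⟨min (Real.exp (-(8 * C))) ((ε c₀ / 2) ^ K),
    lt_min (Real.exp_pos _) (pow_pos (half_pos (hε c₀)) _), ?_⟩
  filter_upwards [h1, hall, eventually_ge_atTop 3, big (64 * Λ ^ 2), big (2 * (64 * Λ)),
    big (2 * K / ε c₀)] with N hd ht hN3 hN64 hN128 hNK
  have hT := hN N (by omega)
  by_cases hr : 64 * Λ * (S N).row 1 ≤ N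
  · refine (min_le_left _ _).trans ?_
    exact (S N).le_probBinary_of_light C Λ (by linarith) (by linarith) (by omega)
      (by rw [hT]; exact hN64) (by rw [hT]; exact hd) (hrc N (by omega)) (by rw [hT]; exact hr)
  · push Not at hr
    have hS := (S N).pairCount_col_le C (64 * Λ) (by positivity) (by rw [hT]; exact hd)
      (by rw [hT]; exact hr) (by rw [hT]; exact hN128)
    have hSK : pairCount (S N).c ≤ K := by exact_mod_cast hS.trans hK
    have hcol : (S N).col 1 < K + 2 := by
      have := leading_mul_le_pairCount (S N).c
      rw [← Margins.col_one] at this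
      by_contra! hge
      have h3 : (K + 2) * (K + 1) ≤ (S N).col 1 * ((S N).col 1 - 1) :=
        Nat.mul_le_mul hge (by omega)
      nlinarith
    refine (min_le_right _ _).trans ?_
    refine (S N).le_probBinary_of_few K (ε c₀) (hε c₀) hSK ?_ (by omega) ?_
    · rw [hT]
      rw [div_le_iff₀ (hε c₀)] at hNK
      linarith
    · exact (hc₀ _ (Finset.mem_range.2 hcol)).trans (ht _ (Finset.mem_range.2 hcol) rfl)

end Asymptotic

theorem theorem1 (S : ℕ → Margins)
    (hN : ∀ N : ℕ, 1 ≤ N → (S N).total = N)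
    (hrc : ∀ N : ℕ, 1 ≤ N → (S N).col 1 ≤ (S N).row 1) :
    ((fun _ : ℕ => (1 : ℝ)) =O[atTop] (fun N : ℕ => (S N).probBinary)) ↔
      ((fun N : ℕ => (S N).doubleSum) =O[atTop] (fun N : ℕ => (N : ℝ) ^ 2)) ∧
      (∀ k : ℕ → ℕ, StrictMono k → kappa (fun l => S (k l)) ≠ ⊤ →
        0 < limsup (fun l : ℕ => (S (k l)).tail (kappa (fun l => S (k l)))) atTop ∨
        limsup (fun l : ℕ => ((S (k l)).col 1 : ℕ∞)) atTop < kappa (fun l => S (k l))) := by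
  rw [isBigO_one_probBinary_iff]
  constructor
  · rintro ⟨η, hη, hP⟩
    -- `48 / η` is the size of `N` from which the term `12 / N` of the second moment bound is harmless
    refine ⟨?_, fun k hk hκ => limsup_of_le_probBinary (fun l => S (k l)) η hη
      (hk.tendsto_atTop.eventually hP) hκ⟩
    refine IsBigO.of_bound (16 / η + (64 / η) ^ 2) ?_
    filter_upwards [hP, eventually_ge_atTop 6,
      tendsto_natCast_atTop_atTop.eventually_ge_atTop (48 / η)] with N hp h6 h48
    have hT := hN N (by omega)
    rw [Real.norm_of_nonneg (S N).doubleSum_nonneg, Real.norm_of_nonneg (by positivity)]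
    have := (S N).doubleSum_le_of_le_probBinary η hη (by omega) (by rw [hT]; exact h48) hp
    rwa [hT] at this
  · rintro ⟨h1, h2⟩
    obtain ⟨C, hC, hb⟩ := isBigO_iff'.1 h1
    refine exists_le_probBinary S hN hrc C hC ?_ (eventually_le_tail S hN h2)
    filter_upwards [hb] with N h
    rwa [Real.norm_of_nonneg (S N).doubleSum_nonneg, Real.norm_of_nonneg (by positivity)] at h
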